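/- Let $\mathcal H=L^2(\mathbb R^m)$ be the Hilbert space of $m$ optical modes with quadratures $\hat Q=(\hat X_1,\hat P_1,\dots,\hat X_m,\hat P_m)$, displacement operators $D_r=\exp(i\,r\cdot\hat Q)$ ($r\in\mathbb R^{2m}$), and characteristic functions $\chi_\tau(r)=\operatorname{tr}(D_r\tau)$. A state is a positive trace-class operator of trace one. Let the filter $\Pi$ be an injective operator that is a positive multiple of a Gaussian state $\sigma$ with zero first moments, i.e. $\chi_\sigma(r)=\exp(-\tfrac14 r^{T}\Gamma r)$ with $\Gamma$ real symmetric, and let $P=\Pi^{1/2}$. For a state $\rho$ on $\mathcal H$ define the filtered object $\tau(\rho)=P\rho P/\operatorname{tr}(P\rho P)$. For $R\in[0,1]$ and $T=1-R$ let $U_R$ be the unitary on $\mathcal H_A\otimes\mathcal H_B=L^2(\mathbb R^m\times\mathbb R^m)$ that mixes each pair of modes $Aj,Bj$ on a beam splitter of reflectivity $R$: $(U_R\psi)(x,y)=\psi(\sqrt T x-\sqrt R y,\ \sqrt R x+\sqrt T y)$, so that $U_R^\dagger\hat a_{Aj}U_R=\sqrt T\,\hat a_{Aj}+\sqrt R\,\hat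 a_{Bj}$ and $U_R^\dagger\hat a_{Bj}U_R=-\sqrt R\,\hat a_{Aj}+\sqrt T\,\hat a_{Bj}$. The building block with reflectivity $R$ maps states $\rho_A,\rho_B$ on $\mathcal H$ to $$\mathcal B_R(\rho_A,\rho_B)=\frac{X}{\operatorname{tr}X},\qquad X=\operatorname{tr}_B\big[U_R(\rho_A\otimes\rho_B)U_R^\dagger(1\otimes\Pi)\big].$$ Then the following hold. 1. For every $R\in[0,1]$, $U_R^\dagger(P\otimes P)U_R=P\otimes P$. 2. For every $R\in[0,1]$ and all states $\rho_A,\rho_B$, the output $\rho'=\mathcal B_R(\rho_A,\rho_B)$ and the filtered objects $\tau_A=\tau(\rho_A)$, $\tau_B=\tau(\rho_B)$, $\tau'=\tau(\rho')$ are well-defined states, and for all $r\in\mathbb R^{2m}$ $$\chi_{\tau'}(r)=\chi_{\tau_A}(\sqrt T\,r)\,\chi_{\tau_B}(\sqrt R\,r).$$ 3. (Pumping-Gaussifier.) Let $\rho_1$ be any state and $\rho_{N+1}=\mathcal B_{R_N}(\rho_N,\rho_1)$ with $R_N=1/(N+1)$ for $N\ge1$, and put $\tau_N=\tau(\rho_N)$.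 Then for all $N\ge1$ the operators $\rho_N$ and $\tau_N$ are states, and for all $r\in\mathbb R^{2m}$ $$\chi_{\tau_{N+1}}(r)=\chi_{\tau_N}\!\Big(\tfrac{\sqrt N}{\sqrt{N+1}}\,r\Big)\chi_{\tau_1}\!\Big(\tfrac{1}{\sqrt{N+1}}\,r\Big),\qquad \chi_{\tau_N}(r)=\chi_{\tau_1}\!\Big(\tfrac{r}{\sqrt N}\Big)^{N}.$$ 4. (Comparison with the recursive Gaussifier.) Let $\rho^{\mathrm{rec}}_0=\rho_1$ and $\rho^{\mathrm{rec}}_{n+1}=\mathcal B_{1/2}(\rho^{\mathrm{rec}}_n,\rho^{\mathrm{rec}}_n)$. Then for every $n\ge0$, with $N=2^n$ (so $n=\log_2N$), $\rho^{\mathrm{rec}}_n$ is a state, $\rho_N=\rho^{\mathrm{rec}}_n$, and in particular the filtered objects $\tau_N=\tau(\rho_N)$ and $\tau(\rho^{\mathrm{rec}}_n)$ have the same characteristic function. -/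

import Mathlib

open MeasureTheory
open scoped InnerProductSpace TensorProduct ComplexOrder

noncomputable section

namespace Gaussifier

/-! ### Trace-class operators and density operators on a Hilbert space -/

section Trace

variable {E : Type*} [NormedAddCommGroup E] [InnerProductSpace ℂ E] [CompleteSpace E]

variable (E) in
/-- Index set of a fixed Hilbert basis (complete orthonormal system) of `E`. -/
def basisIndex : Set E := (exists_hilbertBasis ℂ E).choose

variable (E) in
/-- A fixed Hilbert basis (complete orthonormal system) of `E`. -/
def stdBasis : HilbertBasis (basisIndex E) ℂ E := (exists_hilbertBasis ℂ E).choose_spec.choose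

/-- `T` is trace class: the diagonal of `|T| = √(T† T)` is summable. -/
def IsTraceClass (T : E →L[ℂ] E) : Prop :=
  Summable fun i => ⟪stdBasis E i, CFC.abs T (stdBasis E i)⟫_ℂ

/-- The trace `tr T = ∑ ⟨eᵢ, T eᵢ⟩` (meaningful, and independent of the basis, for trace-class `T`). -/
def opTrace (T : E →L[ℂ] E) : ℂ := ∑' i, ⟪stdBasis E i, T (stdBasis E i)⟫_ℂ

/-- Quantum states: positive trace-class operators of unit trace. -/
def IsDensity (ρ : E →L[ℂ] E) : Prop := 0 ≤ ρ ∧ IsTraceClass ρ ∧ opTrace ρ = 1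

/-- The positive square root `√T` of a positive operator. -/
def opSqrt (T : E →L[ℂ] E) : E →L[ℂ] E := CFC.sqrt T

/-- Rescaling of an operator to unit trace. -/
def normalize (T : E →L[ℂ] E) : E →L[ℂ] E := (opTrace T)⁻¹ • T

end Trace

/-! ### Continuous-variable systems: `m` modes, and two copies `A`, `B` of `m` modes -/

/-- The Hilbert space `L²(ℝᵐ)` of `m` optical modes, in the Schrödinger representation: `X_j` is
multiplication by the `j`-th coordinate and `P_j = -i ∂_j`. -/
abbrev Modes (m : ℕ) : Type := Lp ℂ 2 (volume : Measure (Fin m → ℝ))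

/-- The Hilbert space `L²(ℝᵐ × ℝᵐ)` of the `2m` modes `A1, …, Am, B1, …, Bm`. -/
abbrev TwoModes (m : ℕ) : Type := Lp ℂ 2 (volume : Measure ((Fin m → ℝ) × (Fin m → ℝ)))

/-- Points of the phase space `ℝ²ᵐ`: `r (j, 0)` is the coefficient of `X_j` and `r (j, 1)` that of
`P_j` in `r · Q`. -/
abbrev Phase (m : ℕ) : Type := Fin m × Fin 2 → ℝ

/-! ### Displacement (Weyl) operators and characteristic functions -/

/-- The phase `exp (i x·q + i x·p / 2)`, where `x` and `p` are the `X`- and `P`-coefficients in `r`. -/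
def weylPhase {m : ℕ} (r : Phase m) (q : Fin m → ℝ) : ℂ :=
  Complex.exp ((((∑ j, r (j, 0) * q j) + (∑ j, r (j, 0) * r (j, 1)) / 2 : ℝ) : ℂ) * Complex.I)

lemma norm_weylPhase {m : ℕ} (r : Phase m) (q : Fin m → ℝ) : ‖weylPhase r q‖ = 1 :=
  Complex.norm_exp_ofReal_mul_I _

lemma continuous_weylPhase {m : ℕ} (r : Phase m) : Continuous (weylPhase r) := by
  unfold weylPhase; fun_prop

lemma measurePreserving_shift {m : ℕ} (r : Phase m) :
    MeasurePreserving (fun q : Fin m → ℝ => q + fun j => r (j, 1)) volume volume :=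
  measurePreserving_add_right volume _

lemma memLp_phaseMul {m : ℕ} (r : Phase m) (ψ : Modes m) :
    MemLp (fun q => weylPhase r q * ψ q) 2 volume :=
  (Lp.memLp ψ).of_le ((continuous_weylPhase r).aestronglyMeasurable.mul (Lp.aestronglyMeasurable ψ))
    (Filter.Eventually.of_forall fun q => by simp [norm_weylPhase])

/-- Multiplication by `weylPhase r`, a unitary operator. -/
def phaseMul {m : ℕ} (r : Phase m) : Modes m →ₗᵢ[ℂ] Modes m where
  toFun ψ := (memLp_phaseMul r ψ).toLp _
  map_add' ψ φ := by
    apply Lp.ext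
    filter_upwards [(memLp_phaseMul r (ψ + φ)).coeFn_toLp, (memLp_phaseMul r ψ).coeFn_toLp,
      (memLp_phaseMul r φ).coeFn_toLp, Lp.coeFn_add ψ φ,
      Lp.coeFn_add ((memLp_phaseMul r ψ).toLp _) ((memLp_phaseMul r φ).toLp _)] with q h1 h2 h3 h4 h5
    rw [h1, h5, Pi.add_apply, h2, h3, h4, Pi.add_apply, mul_add]
  map_smul' c ψ := by
    apply Lp.ext
    filter_upwards [(memLp_phaseMul r (c • ψ)).coeFn_toLp, (memLp_phaseMul r ψ).coeFn_toLp,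
      Lp.coeFn_smul c ψ, Lp.coeFn_smul c ((memLp_phaseMul r ψ).toLp _)] with q h1 h2 h3 h4
    rw [h1, RingHom.id_apply, h4, Pi.smul_apply, h2, h3, Pi.smul_apply, smul_eq_mul, smul_eq_mul]
    ring
  norm_map' ψ := by
    change ‖(memLp_phaseMul r ψ).toLp _‖ = ‖ψ‖
    rw [Lp.norm_toLp, Lp.norm_def]
    congr 1
    exact eLpNorm_congr_norm_ae (Filter.Eventually.of_forall fun q => by simp [norm_weylPhase])

/-- The displacement operator `D_r = exp (i r · Q) = exp (i (x·X + p·P))`. In the Schrödinger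
representation `(D_r ψ)(q) = exp (i x·q + i x·p / 2) ψ(q + p)`. -/
def weyl {m : ℕ} (r : Phase m) : Modes m →L[ℂ] Modes m :=
  (phaseMul r).toContinuousLinearMap ∘L
    (Lp.compMeasurePreservingₗᵢ ℂ _ (measurePreserving_shift r)).toContinuousLinearMap

/-- The explicit form of the displacement operator. -/
lemma weyl_apply {m : ℕ} (r : Phase m) (ψ : Modes m) :
    weyl r ψ =ᵐ[volume] fun q => weylPhase r q * ψ (q + fun j => r (j, 1)) := by
  have h1 : weyl r ψ =ᵐ[volume] fun q => weylPhase r q *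
      (Lp.compMeasurePreserving _ (measurePreserving_shift r) ψ : Modes m) q :=
    (memLp_phaseMul r _).coeFn_toLp
  have h2 := Lp.coeFn_compMeasurePreserving ψ (measurePreserving_shift r)
  filter_upwards [h1, h2] with q h1 h2
  rw [h1, h2]; rfl

/-- The characteristic function `χ_τ(r) = tr (D_r τ)`. -/
def charFn {m : ℕ} (τ : Modes m →L[ℂ] Modes m) (r : Phase m) : ℂ := opTrace (weyl r * τ)

/-- `σ` is the Gaussian state with first moments `d` and covariance matrix `Γ`:
`χ_σ(r) = exp (i r·d - rᵀ Γ r / 4)`. -/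
def IsGaussianState {m : ℕ} (σ : Modes m →L[ℂ] Modes m) (d : Phase m)
    (Γ : Matrix (Fin m × Fin 2) (Fin m × Fin 2) ℝ) : Prop :=
  IsDensity σ ∧ Γ.IsSymm ∧
    ∀ r, charFn σ r = Complex.exp (Complex.I * ((r ⬝ᵥ d : ℝ) : ℂ) - ((r ⬝ᵥ Γ.mulVec r : ℝ) : ℂ) / 4)

/-- Admissible filters: invertible (i.e. injective, full-rank) operators proportional to a
Gaussian state with zero first moments. -/
def IsGaussianFilter {m : ℕ} (F : Modes m →L[ℂ] Modes m) : Prop :=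
  Function.Injective F ∧
    ∃ c : ℝ, 0 < c ∧ ∃ σ Γ, IsGaussianState σ 0 Γ ∧ F = (c : ℂ) • σ

/-! ### Tensor products -/

section Tensor

variable {m : ℕ}

lemma memLp_prodFun (f g : Modes m) :
    MemLp (fun z : (Fin m → ℝ) × (Fin m → ℝ) => f z.1 * g z.2) 2 volume := by
  have hm : AEStronglyMeasurable (fun z : (Fin m → ℝ) × (Fin m → ℝ) => f z.1 * g z.2) volume :=
    (Lp.aestronglyMeasurable f).comp_fst.mul (Lp.aestronglyMeasurable g).comp_snd
  rw [memLp_two_iff_integrable_sq_norm hm]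
  have hf := (memLp_two_iff_integrable_sq_norm (Lp.aestronglyMeasurable f)).1 (Lp.memLp f)
  have hg := (memLp_two_iff_integrable_sq_norm (Lp.aestronglyMeasurable g)).1 (Lp.memLp g)
  have h := hf.mul_prod hg
  rw [← Measure.volume_eq_prod] at h
  simpa [mul_pow] using h

/-- The product vector `f ⊗ g`, as the function `(x, y) ↦ f x * g y`. -/
def prodVec (f g : Modes m) : TwoModes m := (memLp_prodFun f g).toLp _

lemma coeFn_prodVec (f g : Modes m) : prodVec f g =ᵐ[volume] fun z => f z.1 * g z.2 :=
  MemLp.coeFn_toLp _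

lemma ae_fst {p : (Fin m → ℝ) → Prop} (h : ∀ᵐ x, p x) :
    ∀ᵐ z : (Fin m → ℝ) × (Fin m → ℝ), p z.1 :=
  Measure.quasiMeasurePreserving_fst.ae h

lemma ae_snd {p : (Fin m → ℝ) → Prop} (h : ∀ᵐ x, p x) :
    ∀ᵐ z : (Fin m → ℝ) × (Fin m → ℝ), p z.2 :=
  Measure.quasiMeasurePreserving_snd.ae h

/-- `(f, g) ↦ f ⊗ g` as a bilinear map. -/
def prodBilin : Modes m →ₗ[ℂ] Modes m →ₗ[ℂ] TwoModes m :=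
  LinearMap.mk₂ ℂ prodVec
    (fun f f' g => by
      apply Lp.ext
      filter_upwards [coeFn_prodVec (f + f') g, coeFn_prodVec f g, coeFn_prodVec f' g,
        Lp.coeFn_add (prodVec f g) (prodVec f' g), ae_fst (Lp.coeFn_add f f')] with z h1 h2 h3 h4 h5
      rw [h1, h4, Pi.add_apply, h2, h3, h5, Pi.add_apply, add_mul])
    (fun c f g => by
      apply Lp.ext
      filter_upwards [coeFn_prodVec (c • f) g, coeFn_prodVec f g,
        Lp.coeFn_smul c (prodVec f g), ae_fst (Lp.coeFn_smul c f)] with z h1 h2 h3 h4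
      rw [h1, h3, Pi.smul_apply, h2, h4, Pi.smul_apply, smul_eq_mul, smul_eq_mul, mul_assoc])
    (fun f g g' => by
      apply Lp.ext
      filter_upwards [coeFn_prodVec f (g + g'), coeFn_prodVec f g, coeFn_prodVec f g',
        Lp.coeFn_add (prodVec f g) (prodVec f g'), ae_snd (Lp.coeFn_add g g')] with z h1 h2 h3 h4 h5
      rw [h1, h4, Pi.add_apply, h2, h3, h5, Pi.add_apply, mul_add])
    (fun c f g => by
      apply Lp.ext
      filter_upwards [coeFn_prodVec f (c • g), coeFn_prodVec f g,
        Lp.coeFn_smul c (prodVec f g), ae_snd (Lp.coeFn_smul c g)] with z h1 h2 h3 h4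
      rw [h1, h3, Pi.smul_apply, h2, h4, Pi.smul_apply, smul_eq_mul, smul_eq_mul]
      ring)

lemma inner_prodVec (f g f' g' : Modes m) :
    ⟪prodVec f g, prodVec f' g'⟫_ℂ = ⟪f, f'⟫_ℂ * ⟪g, g'⟫_ℂ := by
  simp only [L2.inner_def]
  rw [← integral_prod_mul]
  apply integral_congr_ae
  filter_upwards [coeFn_prodVec f g, coeFn_prodVec f' g'] with z h1 h2
  rw [h1, h2]
  simp only [RCLike.inner_apply, map_mul]
  ring

lemma norm_prodVec (f g : Modes m) : ‖prodVec f g‖ = ‖f‖ * ‖g‖ := by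
  have h := inner_prodVec f g f g
  simp only [inner_self_eq_norm_sq_to_K] at h
  have h' : ‖prodVec f g‖ ^ 2 = (‖f‖ * ‖g‖) ^ 2 := by
    rw [mul_pow]; exact_mod_cast h
  exact (pow_left_inj₀ (norm_nonneg _) (by positivity) two_ne_zero).1 h'

/-- The canonical isometric embedding of the algebraic tensor product into `L²(ℝᵐ × ℝᵐ)`. -/
def tensorEmb : Modes m ⊗[ℂ] Modes m →ₗᵢ[ℂ] TwoModes m :=
  (TensorProduct.lift prodBilin).isometryOfInner (by
    intro x y
    induction x using TensorProduct.induction_on with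
    | zero => simp
    | add x x' hx hx' => simp only [map_add, inner_add_left, hx, hx']
    | tmul f g =>
      induction y using TensorProduct.induction_on with
      | zero => simp
      | add y y' hy hy' => simp only [map_add, inner_add_right, hy, hy']
      | tmul f' g' =>
        simp only [TensorProduct.lift.tmul, TensorProduct.inner_tmul]
        exact inner_prodVec f g f' g')

lemma tensorEmb_tmul (f g : Modes m) : tensorEmb (f ⊗ₜ[ℂ] g) = prodVec f g := rfl

lemma eq_zero_of_forall_inner_prodVec (F : TwoModes m)
    (hF : ∀ f g : Modes m, ⟪prodVec f g, F⟫_ℂ = 0) : F = 0 := by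
  set S : ℕ → Set (Fin m → ℝ) := fun n => Metric.closedBall 0 n with hS
  have hSm : ∀ n, MeasurableSet (S n) := fun n => Metric.isClosed_closedBall.measurableSet
  have hSf : ∀ n, volume (S n) ≠ ⊤ := fun n => measure_closedBall_lt_top.ne
  have hrect : ∀ A B : Set (Fin m → ℝ), MeasurableSet A → MeasurableSet B →
      volume A ≠ ⊤ → volume B ≠ ⊤ → ∫ z in A ×ˢ B, F z = 0 := by
    intro A B hA hB hA' hB'
    rw [← hF (indicatorConstLp 2 hA hA' 1) (indicatorConstLp 2 hB hB' 1), L2.inner_def,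
      ← integral_indicator (hA.prod hB)]
    apply integral_congr_ae
    filter_upwards [coeFn_prodVec (indicatorConstLp 2 hA hA' 1) (indicatorConstLp 2 hB hB' 1),
      ae_fst (indicatorConstLp_coeFn (p := 2) (hs := hA) (hμs := hA') (c := (1 : ℂ))),
      ae_snd (indicatorConstLp_coeFn (p := 2) (hs := hB) (hμs := hB') (c := (1 : ℂ)))] with z h1 h2 h3
    rw [h1, h2, h3]
    by_cases hz1 : z.1 ∈ A <;> by_cases hz2 : z.2 ∈ B <;> simp [Set.indicator, hz1, hz2]
  have hKf : ∀ n, volume (S n ×ˢ S n) ≠ ⊤ := fun n => by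
    rw [Measure.volume_eq_prod, Measure.prod_prod]
    exact ENNReal.mul_ne_top (hSf n) (hSf n)
  have key : ∀ n, F =ᵐ[volume.restrict (S n ×ˢ S n)] 0 := by
    intro n
    have : IsFiniteMeasure (volume.restrict (S n ×ˢ S n)) :=
      ⟨by rw [Measure.restrict_apply_univ]; exact (hKf n).lt_top⟩
    have hint : Integrable F (volume.restrict (S n ×ˢ S n)) :=
      ((Lp.memLp F).restrict _).integrable (by norm_num)
    apply hint.ae_eq_zero_of_forall_setIntegral_eq_zero
    intro s hs _
    induction s, hs using MeasurableSpace.induction_on_inter generateFrom_prod.symm isPiSystem_prod with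
    | empty => simp
    | basic t ht =>
      obtain ⟨A, hA, B, hB, rfl⟩ := ht
      rw [Set.mem_ofPred_eq] at hA hB
      rw [Measure.restrict_restrict (MeasurableSet.prod hA hB), Set.prod_inter_prod]
      exact hrect _ _ (MeasurableSet.inter hA (hSm n)) (MeasurableSet.inter hB (hSm n))
        (measure_ne_top_of_subset Set.inter_subset_right (hSf n))
        (measure_ne_top_of_subset Set.inter_subset_right (hSf n))
    | compl t ht iht =>
      have h := integral_add_compl ht hint
      rw [iht (measure_lt_top _ _), zero_add, hrect _ _ (hSm n) (hSm n) (hSf n) (hSf n)] at h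
      exact h
    | iUnion t hd ht iht =>
      rw [integral_iUnion ht hd hint.integrableOn]
      simp [iht _ (measure_lt_top _ _)]
  have hU : (⋃ n, S n ×ˢ S n) = Set.univ := by
    refine Set.eq_univ_of_forall fun z => ?_
    obtain ⟨n, hn⟩ := exists_nat_ge ‖z‖
    refine Set.mem_iUnion.2 ⟨n, ?_, ?_⟩
    · simpa [hS] using (norm_fst_le z).trans hn
    · simpa [hS] using (norm_snd_le z).trans hn
  have h := (ae_restrict_iUnion_iff (fun n => S n ×ˢ S n) (fun z => F z = 0)).2 key
  rw [hU, Measure.restrict_univ] at h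
  apply Lp.ext
  filter_upwards [h, Lp.coeFn_zero ℂ 2 (volume : Measure ((Fin m → ℝ) × (Fin m → ℝ)))] with z h1 h2
  rw [h1, h2]; rfl

lemma denseRange_tensorEmb :
    DenseRange (tensorEmb (m := m)).toContinuousLinearMap := by
  have h : (LinearMap.range (tensorEmb (m := m)).toLinearMap).topologicalClosure = ⊤ := by
    rw [Submodule.topologicalClosure_eq_top_iff, Submodule.eq_bot_iff]
    intro F hF
    refine eq_zero_of_forall_inner_prodVec F fun f g => ?_
    exact hF _ ⟨f ⊗ₜ[ℂ] g, rfl⟩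
  exact Submodule.dense_iff_topologicalClosure_eq_top.2 h

/-- The tensor product `A ⊗ B` of bounded operators: the bounded operator on `L²(ℝᵐ × ℝᵐ)`
with `(A ⊗ B)(f ⊗ g) = A f ⊗ B g`. -/
def tensorOp (A B : Modes m →L[ℂ] Modes m) : TwoModes m →L[ℂ] TwoModes m :=
  (tensorEmb.toContinuousLinearMap ∘L TensorProduct.mapL A B).extend
    tensorEmb.toContinuousLinearMap

lemma tensorOp_prodVec (A B : Modes m →L[ℂ] Modes m) (f g : Modes m) :
    tensorOp A B (prodVec f g) = prodVec (A f) (B g) := by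
  have h := ContinuousLinearMap.extend_eq
    (tensorEmb.toContinuousLinearMap ∘L TensorProduct.mapL A B) denseRange_tensorEmb
    (tensorEmb (m := m)).isometry.isUniformInducing (f ⊗ₜ[ℂ] g)
  exact h

/-- The bounded operator `f ↦ f ⊗ g` from the modes `A` to the modes `A` and `B`. -/
def tensorRight (g : Modes m) : Modes m →L[ℂ] TwoModes m :=
  (prodBilin.flip g).mkContinuous ‖g‖ fun f => by
    rw [mul_comm]; exact (norm_prodVec f g).le

lemma tensorRight_apply (f g : Modes m) : tensorRight g f = prodVec f g := rfl

/-- The partial trace over the modes `B`: `tr_B W = ∑ₖ (1 ⊗ ⟨eₖ|) W (1 ⊗ |eₖ⟩)` for a complete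
orthonormal system `eₖ`. For trace-class `W` the series converges absolutely in operator norm. -/
def partialTrace (W : TwoModes m →L[ℂ] TwoModes m) : Modes m →L[ℂ] Modes m :=
  ∑' k, (tensorRight (stdBasis (Modes m) k)).adjoint ∘L W ∘L tensorRight (stdBasis (Modes m) k)

end Tensor

/-! ### Beam splitters -/

section BeamSplitter

/-- `(x, y) ↦ (√T x - √R y, √R x + √T y)` with `T = 1 - R`, acting modewise. -/
def rotation (m : ℕ) (R : unitInterval) :
    (Fin m → ℝ) × (Fin m → ℝ) →ₗ[ℝ] (Fin m → ℝ) × (Fin m → ℝ) where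
  toFun z := (√(1 - R : ℝ) • z.1 - √(R : ℝ) • z.2, √(R : ℝ) • z.1 + √(1 - R : ℝ) • z.2)
  map_add' z w := by ext j <;> simp <;> ring
  map_smul' c z := by ext j <;> simp <;> ring

/-- The sign change `(x, y) ↦ (x, -y)`. -/
def flipSnd (m : ℕ) : (Fin m → ℝ) × (Fin m → ℝ) →ₗ[ℝ] (Fin m → ℝ) × (Fin m → ℝ) where
  toFun z := (z.1, -z.2)
  map_add' z w := by ext j <;> simp; ring
  map_smul' c z := by ext j <;> simp

lemma abs_det_rotation (m : ℕ) (R : unitInterval) : |LinearMap.det (rotation m R)| = 1 := by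
  have hR : √(R : ℝ) * √(R : ℝ) = R := Real.mul_self_sqrt R.2.1
  have hT : √(1 - R : ℝ) * √(1 - R : ℝ) = 1 - R := Real.mul_self_sqrt (sub_nonneg.2 R.2.2)
  have hSS : flipSnd m * flipSnd m = 1 := by
    refine LinearMap.ext fun z => ?_
    simp [flipSnd]
  have hRS : flipSnd m * rotation m R * flipSnd m * rotation m R = 1 := by
    refine LinearMap.ext fun z => ?_
    refine Prod.ext (funext fun j => ?_) (funext fun j => ?_)
    · change √(1 - R : ℝ) * (√(1 - R : ℝ) * z.1 j - √(R : ℝ) * z.2 j) -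
        √(R : ℝ) * (-(√(R : ℝ) * z.1 j + √(1 - R : ℝ) * z.2 j)) = z.1 j
      linear_combination (z.1 j) * (hR + hT)
    · change -(√(R : ℝ) * (√(1 - R : ℝ) * z.1 j - √(R : ℝ) * z.2 j) +
        √(1 - R : ℝ) * (-(√(R : ℝ) * z.1 j + √(1 - R : ℝ) * z.2 j))) = z.2 j
      linear_combination (z.2 j) * (hR + hT)
  have h1 := congrArg LinearMap.det hSS
  have h2 := congrArg LinearMap.det hRS
  simp only [map_mul, map_one] at h1 h2
  have h3 : LinearMap.det (rotation m R) ^ 2 = 1 := by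
    linear_combination h2 - LinearMap.det (rotation m R) ^ 2 * h1
  rcases sq_eq_one_iff.mp h3 with h | h <;> simp [h]

lemma measurePreserving_rotation (m : ℕ) (R : unitInterval) :
    MeasurePreserving (rotation m R) volume volume := by
  refine ⟨(LinearMap.continuous_of_finiteDimensional _).measurable, ?_⟩
  have h0 : LinearMap.det (rotation m R) ≠ 0 := fun h => by
    have := abs_det_rotation m R
    simp [h] at this
  have : (volume : Measure ((Fin m → ℝ) × (Fin m → ℝ))).IsAddHaarMeasure := by
    exact Measure.prod.instIsAddHaarMeasure _ _
  rw [Measure.map_linearMap_addHaar_eq_smul_addHaar _ h0, abs_inv, abs_det_rotation]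
  simp

/-- The beam splitters of reflectivity `R`, one for each pair `Aj`, `Bj`:
`(U ψ)(x, y) = ψ (√T x - √R y, √R x + √T y)`. In the Heisenberg picture
`U† a_{Aj} U = √T a_{Aj} + √R a_{Bj}` and `U† a_{Bj} U = -√R a_{Aj} + √T a_{Bj}`. -/
def beamSplitter (m : ℕ) (R : unitInterval) : TwoModes m →L[ℂ] TwoModes m :=
  (Lp.compMeasurePreservingₗᵢ ℂ _ (measurePreserving_rotation m R)).toContinuousLinearMap

end BeamSplitter

/-! ### Building blocks and protocols -/

section Protocols

variable {m : ℕ}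

/-- The filtered object `τ = P ρ P / tr (P ρ P)` with `P = F^{1/2}`. -/
def filtered (F ρ : Modes m →L[ℂ] Modes m) : Modes m →L[ℂ] Modes m :=
  normalize (opSqrt F * ρ * opSqrt F)

/-- The unnormalized output `tr_B [U (ρ_A ⊗ ρ_B) U† (1 ⊗ F)]` of a building block with filter `F`
and beam-splitter reflectivity `R`. -/
def blockOp (F : Modes m →L[ℂ] Modes m) (R : unitInterval) (ρA ρB : Modes m →L[ℂ] Modes m) :
    Modes m →L[ℂ] Modes m :=
  partialTrace (beamSplitter m R * tensorOp ρA ρB * (beamSplitter m R).adjoint * tensorOp 1 F)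

/-- The state output by a successful building block. -/
def buildingBlock (F : Modes m →L[ℂ] Modes m) (R : unitInterval)
    (ρA ρB : Modes m →L[ℂ] Modes m) : Modes m →L[ℂ] Modes m :=
  normalize (blockOp F R ρA ρB)

/-- The reflectivity `1 / (N + 1)` of the `N`-th pumping step. -/
def pumpReflectivity (N : ℕ) : unitInterval :=
  ⟨1 / ((N : ℝ) + 1), by positivity,
    div_le_one_of_le₀ (le_add_of_nonneg_left (Nat.cast_nonneg N)) (by positivity)⟩

/-- The pumping-Gaussifier: `pumpState F ρ₁ N` is the state `ρ_N`. The `N`-th step mixes `ρ_N` with a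
raw copy of `ρ₁` on a beam splitter of reflectivity `1 / (N + 1)`. The sequence starts at `N = 1`;
the entry at `0` is a placeholder. -/
def pumpState (F ρ₁ : Modes m →L[ℂ] Modes m) : ℕ → (Modes m →L[ℂ] Modes m)
  | 0 => 0
  | 1 => ρ₁
  | N + 2 => buildingBlock F (pumpReflectivity (N + 1)) (pumpState F ρ₁ (N + 1)) ρ₁

/-- The reflectivity `1 / 2`. -/
def halfReflectivity : unitInterval := ⟨1 / 2, by norm_num, by norm_num⟩

/-- The recursive Gaussifier: the state after `n` rounds, each of which combines two copies of the
previous output on a balanced beam splitter. -/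
def recursiveState (F ρ₁ : Modes m →L[ℂ] Modes m) : ℕ → (Modes m →L[ℂ] Modes m)
  | 0 => ρ₁
  | n + 1 => buildingBlock F halfReflectivity (recursiveState F ρ₁ n) (recursiveState F ρ₁ n)

end Protocols

end Gaussifier

end

open Gaussifier

/-!
The beam splitters act on phase space as rotations. They therefore fix the two-copy Gaussian
`σ ⊗ σ`, whose characteristic function is a function of a rotation-invariant quadratic form
(`IsGaussianState.conj_beamSplitter`), hence also `F ⊗ F` and, by uniqueness of positive square
roots, `P ⊗ P` with `P = √F` (`IsGaussianFilter.conj_beamSplitter_opSqrt`).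

By cyclicity of the partial trace over the second output, the filter `F` on that output can be
written as `P` on both sides. If the first output is filtered by `P` as well, then `P ⊗ P` moves
through the beam splitters to the inputs:
`P X P = tr_B [U (P ρ_A P ⊗ P ρ_B P) U†]` for the unnormalized output `X`
(`opSqrt_mul_blockOp_mul`). Displacement operators are rotated by the beam splitters, and the
product formula for the characteristic functions of the filtered objects follows
(`charFn_filtered_buildingBlock`). Its iteration gives `χ(r / √N) ^ N` both for `N - 1` steps of
the pumping protocol and for `log₂ N` rounds of the recursive one; since `P` is injective and
characteristic functions are injective on trace-class operators, the two states agree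
(`eq_of_charFn_filtered`).

Two analytic facts carry the argument. Trace-class operators are handled through expansions
`T = ∑ᵢ |uᵢ⟩⟨vᵢ|` with square-summable families (`IsSchmidt`), for which traces, tensor products
and partial traces can be computed by rearranging absolutely convergent series. Injectivity of the
characteristic function (`IsSchmidt.eq_zero_of_fourier`) holds because, for a fixed position shift
`α`, it is the Fourier transform of the integrable function `q ↦ ∑ᵢ conj (vᵢ q) uᵢ (q + α)`, a
diagonal of the integral kernel of `T`.
-/

noncomputable section

namespace Gaussifier

/-! ### Expansions of trace-class operators into operators of rank one -/

section Schmidt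

variable {E : Type*} [NormedAddCommGroup E] [InnerProductSpace ℂ E]
variable {ι κ : Type*}

/-- `T = ∑ᵢ |uᵢ⟩⟨vᵢ|` with square-summable families `u` and `v`. No orthogonality is asked of the
families, so that such expansions pass to products, sums and partial traces of operators. The sum is
encoded weakly, through the matrix elements of `T`; by `IsSchmidt.eq_tsum` it converges in operator
norm as well. -/
structure IsSchmidt (T : E →L[ℂ] E) (u v : ι → E) : Prop where
  left : Summable fun i => ‖u i‖ ^ 2
  right : Summable fun i => ‖v i‖ ^ 2
  hasSum : ∀ f g, HasSum (fun i => ⟪g, u i⟫_ℂ * ⟪v i, f⟫_ℂ) ⟪g, T f⟫_ℂ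

lemma opTrace_smul [CompleteSpace E] (c : ℂ) (T : E →L[ℂ] E) :
    opTrace (c • T) = c * opTrace T := by
  unfold opTrace
  rw [← tsum_mul_left]
  simp only [smul_apply, inner_smul_right]

lemma summable_norm_mul_norm {E₁ E₂ : Type*} [NormedAddCommGroup E₁] [NormedAddCommGroup E₂]
    {u : ι → E₁} {v : ι → E₂} (hu : Summable fun i => ‖u i‖ ^ 2)
    (hv : Summable fun i => ‖v i‖ ^ 2) : Summable fun i => ‖u i‖ * ‖v i‖ := by
  refine Summable.of_nonneg_of_le (fun i => by positivity) (fun i => ?_) (hu.add hv)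
  nlinarith [sq_nonneg (‖u i‖ - ‖v i‖), sq_nonneg (‖u i‖), sq_nonneg (‖v i‖)]

lemma summable_norm_apply_sq {E₁ E₂ : Type*} [NormedAddCommGroup E₁] [NormedSpace ℂ E₁]
    [NormedAddCommGroup E₂] [NormedSpace ℂ E₂] (C : E₁ →L[ℂ] E₂) {w : ι → E₁}
    (hw : Summable fun i => ‖w i‖ ^ 2) : Summable fun i => ‖C (w i)‖ ^ 2 := by
  refine Summable.of_nonneg_of_le (fun i => by positivity) (fun i => ?_) (hw.mul_left (‖C‖ ^ 2))
  rw [← mul_pow]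
  exact pow_le_pow_left₀ (norm_nonneg _) (C.le_opNorm _) 2

lemma clm_ext_inner {A B : E →L[ℂ] E} (h : ∀ f g, ⟪g, A f⟫_ℂ = ⟪g, B f⟫_ℂ) : A = B :=
  ContinuousLinearMap.ext fun f => ext_inner_left ℂ fun g => h f g

namespace IsSchmidt

variable {T S : E →L[ℂ] E} {u v : ι → E} {u' v' : κ → E}

lemma add (h : IsSchmidt T u v) (h' : IsSchmidt S u' v') :
    IsSchmidt (T + S) (Sum.elim u u') (Sum.elim v v') := by
  refine ⟨?_, ?_, fun f g => ?_⟩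
  · exact (HasSum.sum (f := fun i => ‖Sum.elim u u' i‖ ^ 2) h.left.hasSum h'.left.hasSum).summable
  · exact (HasSum.sum (f := fun i => ‖Sum.elim v v' i‖ ^ 2) h.right.hasSum h'.right.hasSum).summable
  · rw [add_apply, inner_add_right]
    exact HasSum.sum (f := fun i => ⟪g, Sum.elim u u' i⟫_ℂ * ⟪Sum.elim v v' i, f⟫_ℂ)
      (h.hasSum f g) (h'.hasSum f g)

/-- The indices with `uᵢ ≠ 0` suffice, and they are countable in number. -/
lemma restrict (h : IsSchmidt T u v) :
    IsSchmidt T (fun i : (Function.support fun i => ‖u i‖ ^ 2) => u i) (fun i => v i) := by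
  refine ⟨h.left.subtype _, h.right.subtype _, fun f g => ?_⟩
  refine (hasSum_subtype_iff_of_support_subset
    (f := fun i => ⟪g, u i⟫_ℂ * ⟪v i, f⟫_ℂ) fun i hi => ?_).2 (h.hasSum f g)
  intro hu
  have : u i = 0 := by simpa using hu
  exact hi (by simp [this])

/-- The trace can be evaluated on any representation: `tr ∑ₖ |uₖ⟩⟨vₖ| = ∑ₖ ⟨vₖ, uₖ⟩`. -/
lemma hasSum_trace (h : IsSchmidt T u v) {α : Type*} (b : HilbertBasis α ℂ E) :
    HasSum (fun i => ⟪b i, T (b i)⟫_ℂ) (∑' k, ⟪v k, u k⟫_ℂ) := by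
  have hsq : ∀ w : E, HasSum (fun i => ‖⟪b i, w⟫_ℂ‖ ^ 2) (‖w‖ ^ 2) := by
    intro w
    have h1 := b.hasSum_inner_mul_inner w w
    have h2 := h1.mapL Complex.reCLM
    convert h2 using 2 with i
    · rw [← inner_conj_symm w (b i), Complex.conj_mul']
      simp [← Complex.ofReal_pow]
    · rw [inner_self_eq_norm_sq_to_K]
      simp [← Complex.ofReal_pow]
  have hs2 : ∀ w : ι → E, (Summable fun k => ‖w k‖ ^ 2) →
      Summable fun p : ι × α => ‖⟪b p.2, w p.1⟫_ℂ‖ ^ 2 := by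
    intro w hw
    refine (summable_prod_of_nonneg fun p => by positivity).2 ⟨fun k => (hsq (w k)).summable, ?_⟩
    simpa only [(hsq _).tsum_eq] using hw
  -- The double series `∑ᵢ ∑ₖ ⟨bᵢ, uₖ⟩ ⟨vₖ, bᵢ⟩` converges absolutely, and is summed in both orders.
  have hs : Summable fun p : ι × α => ⟪b p.2, u p.1⟫_ℂ * ⟪v p.1, b p.2⟫_ℂ := by
    refine Summable.of_norm ?_
    have := summable_norm_mul_norm (hs2 u h.left) (hs2 v h.right)
    refine this.congr fun p => ?_
    rw [norm_mul, norm_inner_symm (v p.1)]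
  have h1 := hs.hasSum.prod_fiberwise (g := fun k => ⟪v k, u k⟫_ℂ) fun k => by
    simpa only [mul_comm] using b.hasSum_inner_mul_inner (v k) (u k)
  have h2 := ((Equiv.prodComm α ι).hasSum_iff.2 hs.hasSum).prod_fiberwise
    (g := fun i => ⟪b i, T (b i)⟫_ℂ) fun i => h.hasSum (b i) (b i)
  rw [h1.tsum_eq]
  exact h2

lemma nonneg {w : ι → E} (h : IsSchmidt T w w) : 0 ≤ T := by
  rw [ContinuousLinearMap.nonneg_iff_isPositive, ContinuousLinearMap.isPositive_iff_complex]
  intro f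
  have h1 : HasSum (fun i => ((‖⟪w i, f⟫_ℂ‖ ^ 2 : ℝ) : ℂ)) ⟪f, T f⟫_ℂ := by
    convert h.hasSum f f using 2 with i
    rw [← inner_conj_symm f (w i), Complex.conj_mul']
    simp
  have hre : HasSum (fun i => ‖⟪w i, f⟫_ℂ‖ ^ 2) (⟪f, T f⟫_ℂ).re := h1.mapL Complex.reCLM
  have him : (⟪f, T f⟫_ℂ).im = 0 :=
    (h1.mapL Complex.imCLM).unique <| by
      simp only [Complex.imCLM_apply, Complex.ofReal_im]
      exact hasSum_zero
  have hTf : ⟪T f, f⟫_ℂ = (((⟪f, T f⟫_ℂ).re : ℝ) : ℂ) := by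
    rw [← inner_conj_symm]
    apply Complex.ext
    · rw [Complex.conj_re, Complex.ofReal_re]
    · rw [Complex.conj_im, him, neg_zero, Complex.ofReal_im]
  rw [hTf]
  exact ⟨by simp, hre.nonneg fun i => by positivity⟩

end IsSchmidt

variable [CompleteSpace E]

lemma summable_rankOne {u v : ι → E} (hu : Summable fun i => ‖u i‖ ^ 2)
    (hv : Summable fun i => ‖v i‖ ^ 2) :
    Summable fun i => InnerProductSpace.rankOne ℂ (u i) (v i) := by
  refine Summable.of_norm ?_
  simpa only [InnerProductSpace.norm_rankOne] using summable_norm_mul_norm hu hv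

lemma isSchmidt_tsum {u v : ι → E} (hu : Summable fun i => ‖u i‖ ^ 2)
    (hv : Summable fun i => ‖v i‖ ^ 2) :
    IsSchmidt (∑' i, InnerProductSpace.rankOne ℂ (u i) (v i)) u v := by
  refine ⟨hu, hv, fun f g => ?_⟩
  have h := ((innerSL ℂ g).comp (ContinuousLinearMap.apply ℂ E f)).hasSum
    (summable_rankOne hu hv).hasSum
  simpa [mul_comm] using h

namespace IsSchmidt

variable {T S : E →L[ℂ] E} {u v : ι → E} {u' v' : κ → E}

lemma eq_tsum (h : IsSchmidt T u v) : T = ∑' i, InnerProductSpace.rankOne ℂ (u i) (v i) :=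
  clm_ext_inner fun f g => (h.hasSum f g).unique ((isSchmidt_tsum h.left h.right).hasSum f g)

lemma norm_le (h : IsSchmidt T u v) : ‖T‖ ≤ ∑' i, ‖u i‖ * ‖v i‖ := by
  rw [h.eq_tsum]
  have hs := summable_norm_mul_norm h.left h.right
  simpa only [InnerProductSpace.norm_rankOne] using
    norm_tsum_le_tsum_norm (f := fun i => InnerProductSpace.rankOne ℂ (u i) (v i))
      (by simpa only [InnerProductSpace.norm_rankOne] using hs)

lemma conj {E' : Type*} [NormedAddCommGroup E'] [InnerProductSpace ℂ E'] [CompleteSpace E']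
    (h : IsSchmidt T u v) (A : E →L[ℂ] E') (B : E' →L[ℂ] E) :
    IsSchmidt (A ∘L T ∘L B) (fun i => A (u i)) (fun i => B.adjoint (v i)) := by
  refine ⟨summable_norm_apply_sq A h.left, summable_norm_apply_sq B.adjoint h.right, fun f g => ?_⟩
  have := h.hasSum (B f) (A.adjoint g)
  simpa only [ContinuousLinearMap.adjoint_inner_left, ContinuousLinearMap.comp_apply] using this

lemma mul_left (h : IsSchmidt T u v) (A : E →L[ℂ] E) :
    IsSchmidt (A * T) (fun i => A (u i)) v := by
  refine ⟨summable_norm_apply_sq A h.left, h.right, fun f g => ?_⟩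
  have := h.hasSum f (A.adjoint g)
  simp only [ContinuousLinearMap.adjoint_inner_left] at this
  exact this

lemma mul_right (h : IsSchmidt T u v) (B : E →L[ℂ] E) :
    IsSchmidt (T * B) u (fun i => B.adjoint (v i)) := by
  have := h.conj (ContinuousLinearMap.id ℂ E) B
  simpa [ContinuousLinearMap.mul_def] using this

lemma smul (h : IsSchmidt T u v) (c : ℂ) : IsSchmidt (c • T) (fun i => c • u i) v := by
  have := h.mul_left (c • (1 : E →L[ℂ] E))
  simpa using this

lemma neg (h : IsSchmidt T u v) : IsSchmidt (-T) (fun i => - u i) v := by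
  simpa using h.smul (-1)

lemma opTrace_eq (h : IsSchmidt T u v) : opTrace T = ∑' k, ⟪v k, u k⟫_ℂ :=
  (h.hasSum_trace (stdBasis E)).tsum_eq

lemma opTrace_sub (h : IsSchmidt T u v) (h' : IsSchmidt S u' v') :
    opTrace (T - S) = opTrace T - opTrace S := by
  unfold opTrace
  rw [← (h.hasSum_trace (stdBasis E)).summable.tsum_sub (h'.hasSum_trace (stdBasis E)).summable]
  simp only [sub_apply, inner_sub_right]

lemma opTrace_mul_comm (h : IsSchmidt T u v) (A : E →L[ℂ] E) :
    opTrace (A * T) = opTrace (T * A) := by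
  rw [(h.mul_left A).opTrace_eq, (h.mul_right A).opTrace_eq]
  simp only [ContinuousLinearMap.adjoint_inner_left]

/-- `tr (|f⟩⟨g| T)` is a matrix element of `T`. -/
lemma opTrace_rankOne_mul (h : IsSchmidt T u v) (f g : E) :
    opTrace (InnerProductSpace.rankOne ℂ f g * T) = ⟪g, T f⟫_ℂ := by
  rw [(h.mul_left _).opTrace_eq, ← (h.hasSum f g).tsum_eq]
  simp

/-- A trace-class operator is determined by its pairings `tr (A T)` with the bounded operators. -/
lemma ext_opTrace (h : IsSchmidt T u v) (h' : IsSchmidt S u' v')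
    (hTS : ∀ A : E →L[ℂ] E, opTrace (A * T) = opTrace (A * S)) : T = S :=
  clm_ext_inner fun f g => by
    rw [← h.opTrace_rankOne_mul, ← h'.opTrace_rankOne_mul, hTS]

lemma isTraceClass {w : ι → E} (h : IsSchmidt T w w) : IsTraceClass T := by
  unfold IsTraceClass
  rw [CFC.abs_of_nonneg T h.nonneg]
  exact (h.hasSum_trace (stdBasis E)).summable

lemma opTrace_eq_norm {w : ι → E} (h : IsSchmidt T w w) :
    opTrace T = ((∑' k, ‖w k‖ ^ 2 : ℝ) : ℂ) := by
  rw [h.opTrace_eq, Complex.ofReal_tsum]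
  refine tsum_congr fun k => ?_
  rw [inner_self_eq_norm_sq_to_K]
  simp

/-- The trace is faithful on positive operators. -/
lemma eq_zero_of_opTrace {w : ι → E} (h : IsSchmidt T w w) (h0 : opTrace T = 0) : T = 0 := by
  rw [h.opTrace_eq_norm, Complex.ofReal_eq_zero] at h0
  have hw : ∀ k, w k = 0 := fun k => by
    have := (hasSum_zero_iff_of_nonneg fun k => by positivity).1 (h0 ▸ h.left.hasSum)
    simpa using congrFun this k
  refine clm_ext_inner fun f g => (h.hasSum f g).unique ?_
  simp [hw]

end IsSchmidt

lemma adjoint_one : (1 : E →L[ℂ] E).adjoint = 1 := by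
  rw [← ContinuousLinearMap.star_eq_adjoint, star_one]

lemma opSqrt_nonneg (T : E →L[ℂ] E) : 0 ≤ opSqrt T := CFC.sqrt_nonneg T

lemma adjoint_opSqrt (T : E →L[ℂ] E) : (opSqrt T).adjoint = opSqrt T :=
  ContinuousLinearMap.isSelfAdjoint_iff'.1 (CFC.sqrt_nonneg T).isSelfAdjoint

lemma inner_opSqrt (T : E →L[ℂ] E) (f g : E) : ⟪opSqrt T g, f⟫_ℂ = ⟪g, opSqrt T f⟫_ℂ := by
  rw [← ContinuousLinearMap.adjoint_inner_right, adjoint_opSqrt]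

lemma opSqrt_eq_of_mul_self {T Q : E →L[ℂ] E} (hQ : 0 ≤ Q) (h : Q * Q = T) : opSqrt T = Q :=
  CFC.sqrt_unique h

lemma opSqrt_mul_opSqrt {T : E →L[ℂ] E} (h0 : 0 ≤ T) : opSqrt T * opSqrt T = T :=
  CFC.sqrt_mul_sqrt_self T

/-- A positive trace-class operator is `∑ᵢ |√T eᵢ⟩⟨√T eᵢ|`. -/
lemma isSchmidt_opSqrt {T : E →L[ℂ] E} (h0 : 0 ≤ T) (hT : IsTraceClass T) :
    IsSchmidt T (fun i => opSqrt T (stdBasis E i)) (fun i => opSqrt T (stdBasis E i)) := by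
  have hT' : ∀ f g, ⟪g, T f⟫_ℂ = ⟪opSqrt T g, opSqrt T f⟫_ℂ := fun f g => by
    rw [inner_opSqrt, ← mul_apply_eq_comp, opSqrt_mul_opSqrt h0]
  have hsum : Summable fun i => ‖opSqrt T (stdBasis E i)‖ ^ 2 := by
    unfold IsTraceClass at hT
    rw [CFC.abs_of_nonneg T h0] at hT
    refine (hT.mapL Complex.reCLM).congr fun i => ?_
    rw [hT', Complex.reCLM_apply]
    exact inner_self_eq_norm_sq (𝕜 := ℂ) (opSqrt T (stdBasis E i))
  refine ⟨hsum, hsum, fun f g => ?_⟩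
  simpa only [hT', inner_opSqrt] using
    (stdBasis E).hasSum_inner_mul_inner (opSqrt T g) (opSqrt T f)

end Schmidt

/-! ### Tensor products of operators -/

section TensorOperators

variable {m : ℕ}

/-- The bounded operator `g ↦ f ⊗ g` from the modes `B` to the modes `A` and `B`. -/
def tensorLeft (f : Modes m) : Modes m →L[ℂ] TwoModes m :=
  (prodBilin f).mkContinuous ‖f‖ fun g => (norm_prodVec f g).le

lemma tensorLeft_apply (f g : Modes m) : tensorLeft f g = prodVec f g := rfl

lemma orthonormal_prodVec {ι : Type*} {b : ι → Modes m} (hb : Orthonormal ℂ b) :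
    Orthonormal ℂ fun p : ι × ι => prodVec (b p.1) (b p.2) := by
  classical
  rw [orthonormal_iff_ite] at hb ⊢
  rintro ⟨i, j⟩ ⟨k, l⟩
  rw [inner_prodVec, hb, hb]
  by_cases h1 : i = k <;> by_cases h2 : j = l <;> simp [h1, h2]

lemma eq_zero_of_inner_basis {ι E : Type*} [NormedAddCommGroup E] [InnerProductSpace ℂ E]
    (b : HilbertBasis ι ℂ E) {x : E} (h : ∀ i, ⟪b i, x⟫_ℂ = 0) : x = 0 := by
  have := b.hasSum_inner_mul_inner x x
  simp only [h, mul_zero] at this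
  exact inner_self_eq_zero.1 (this.unique hasSum_zero)

/-- The products of the vectors of a Hilbert basis of `L²(ℝᵐ)` form one of `L²(ℝᵐ × ℝᵐ)`. -/
def prodBasis {ι : Type*} (b : HilbertBasis ι ℂ (Modes m)) : HilbertBasis (ι × ι) ℂ (TwoModes m) :=
  HilbertBasis.mkOfOrthogonalEqBot (orthonormal_prodVec b.orthonormal) <| by
    rw [Submodule.eq_bot_iff]
    intro F hF
    have h : ∀ i j, ⟪prodVec (b i) (b j), F⟫_ℂ = 0 := fun i j =>
      hF _ (Submodule.subset_span ⟨(i, j), rfl⟩)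
    have h1 : ∀ j, (tensorRight (b j)).adjoint F = 0 := fun j =>
      eq_zero_of_inner_basis b fun i => by
        rw [ContinuousLinearMap.adjoint_inner_right, tensorRight_apply, h]
    have h2 : ∀ f, (tensorLeft f).adjoint F = 0 := fun f =>
      eq_zero_of_inner_basis b fun j => by
        rw [ContinuousLinearMap.adjoint_inner_right, tensorLeft_apply, ← tensorRight_apply,
          ← ContinuousLinearMap.adjoint_inner_right, h1, inner_zero_right]
    refine eq_zero_of_forall_inner_prodVec F fun f g => ?_
    rw [← tensorLeft_apply, ← ContinuousLinearMap.adjoint_inner_right, h2, inner_zero_right]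

lemma prodBasis_apply {ι : Type*} (b : HilbertBasis ι ℂ (Modes m)) (p : ι × ι) :
    prodBasis b p = prodVec (b p.1) (b p.2) := by
  rw [prodBasis, HilbertBasis.coe_mkOfOrthogonalEqBot]

/-- Completeness in the second factor: `∑ⱼ (1 ⊗ |bⱼ⟩⟨bⱼ|) = 1`, weakly. -/
lemma hasSum_inner_adjoint_tensorRight {ι : Type*} (b : HilbertBasis ι ℂ (Modes m))
    (v u : TwoModes m) :
    HasSum (fun j => ⟪(tensorRight (b j)).adjoint v, (tensorRight (b j)).adjoint u⟫_ℂ)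
      ⟪v, u⟫_ℂ := by
  have h := (prodBasis b).hasSum_inner_mul_inner v u
  rw [← (Equiv.prodComm ι ι).hasSum_iff] at h
  refine h.prod_fiberwise fun j => ?_
  convert b.hasSum_inner_mul_inner ((tensorRight (b j)).adjoint v)
    ((tensorRight (b j)).adjoint u) using 2 with i
  rw [ContinuousLinearMap.adjoint_inner_right, ContinuousLinearMap.adjoint_inner_left,
    tensorRight_apply]
  simp [prodBasis_apply]

lemma hasSum_norm_sq_adjoint_tensorRight {ι : Type*} (b : HilbertBasis ι ℂ (Modes m))
    (u : TwoModes m) : HasSum (fun j => ‖(tensorRight (b j)).adjoint u‖ ^ 2) (‖u‖ ^ 2) := by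
  have h := (hasSum_inner_adjoint_tensorRight b u u).mapL Complex.reCLM
  convert h using 2 with j
  · exact (inner_self_eq_norm_sq (𝕜 := ℂ) _).symm
  · exact (inner_self_eq_norm_sq (𝕜 := ℂ) _).symm

lemma ext_of_prodVec {A B : TwoModes m →L[ℂ] TwoModes m}
    (h : ∀ f g, A (prodVec f g) = B (prodVec f g)) : A = B := by
  refine sub_eq_zero.1 (ContinuousLinearMap.ext fun w => ?_)
  have key : (A - B).adjoint = 0 := ContinuousLinearMap.ext fun F =>
    eq_zero_of_forall_inner_prodVec _ fun f g => by
      rw [ContinuousLinearMap.adjoint_inner_right, sub_apply, h, sub_self, inner_zero_left]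
  rw [← ContinuousLinearMap.adjoint_adjoint (A - B), key]
  simp

lemma ext_of_inner_prodVec {A B : TwoModes m →L[ℂ] TwoModes m}
    (h : ∀ f g f' g', ⟪prodVec f' g', A (prodVec f g)⟫_ℂ = ⟪prodVec f' g', B (prodVec f g)⟫_ℂ) :
    A = B :=
  ext_of_prodVec fun f g => sub_eq_zero.1 <| eq_zero_of_forall_inner_prodVec _ fun f' g' => by
    rw [inner_sub_right, h, sub_self]

lemma tensorOp_one_one : tensorOp (1 : Modes m →L[ℂ] Modes m) 1 = 1 :=
  ext_of_prodVec fun f g => by rw [tensorOp_prodVec]; rfl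

lemma tensorOp_mul (A B C D : Modes m →L[ℂ] Modes m) :
    tensorOp A B * tensorOp C D = tensorOp (A * C) (B * D) :=
  ext_of_prodVec fun f g => by
    rw [mul_apply_eq_comp, tensorOp_prodVec, tensorOp_prodVec, tensorOp_prodVec]; rfl

lemma adjoint_tensorOp (A B : Modes m →L[ℂ] Modes m) :
    (tensorOp A B).adjoint = tensorOp A.adjoint B.adjoint :=
  ext_of_inner_prodVec fun f g f' g' => by
    rw [ContinuousLinearMap.adjoint_inner_right, tensorOp_prodVec, tensorOp_prodVec, inner_prodVec,
      inner_prodVec, ContinuousLinearMap.adjoint_inner_right,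
      ContinuousLinearMap.adjoint_inner_right]

lemma tensorOp_smul_smul (c d : ℂ) (A B : Modes m →L[ℂ] Modes m) :
    tensorOp (c • A) (d • B) = (c * d) • tensorOp A B :=
  ext_of_prodVec fun f g => by
    rw [smul_apply, tensorOp_prodVec, tensorOp_prodVec]
    change prodBilin (c • A f) (d • B g) = (c * d) • prodBilin (A f) (B g)
    simp only [map_smul, LinearMap.smul_apply, smul_smul, mul_comm d c]

lemma tensorOp_nonneg {A B : Modes m →L[ℂ] Modes m} (hA : 0 ≤ A) (hB : 0 ≤ B) :
    0 ≤ tensorOp A B := by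
  have h : tensorOp A B =
      star (tensorOp (opSqrt A) (opSqrt B)) * tensorOp (opSqrt A) (opSqrt B) := by
    rw [ContinuousLinearMap.star_eq_adjoint, adjoint_tensorOp, adjoint_opSqrt, adjoint_opSqrt,
      tensorOp_mul, opSqrt_mul_opSqrt hA, opSqrt_mul_opSqrt hB]
  rw [h]
  exact star_mul_self_nonneg _

lemma adjoint_tensorRight_tensorOp (A : Modes m →L[ℂ] Modes m) (g : Modes m) (w : TwoModes m) :
    (tensorRight g).adjoint (tensorOp A 1 w) = A ((tensorRight g).adjoint w) := by
  refine ext_inner_left ℂ fun f => ?_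
  rw [ContinuousLinearMap.adjoint_inner_right, ← ContinuousLinearMap.adjoint_inner_left,
    ← ContinuousLinearMap.adjoint_inner_left A, ContinuousLinearMap.adjoint_inner_right,
    adjoint_tensorOp, tensorRight_apply, tensorOp_prodVec, tensorRight_apply,
    adjoint_one]
  rfl

lemma IsSchmidt.tensor {ι κ : Type*} {T S : Modes m →L[ℂ] Modes m} {u v : ι → Modes m}
    {u' v' : κ → Modes m} (h : IsSchmidt T u v) (h' : IsSchmidt S u' v') :
    IsSchmidt (tensorOp T S) (fun p : ι × κ => prodVec (u p.1) (u' p.2))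
      (fun p => prodVec (v p.1) (v' p.2)) := by
  have key : ∀ (a : ι → Modes m) (b : κ → Modes m), (Summable fun i => ‖a i‖ ^ 2) →
      (Summable fun i => ‖b i‖ ^ 2) →
      Summable fun p : ι × κ => ‖prodVec (a p.1) (b p.2)‖ ^ 2 := by
    intro a b ha hb
    simp only [norm_prodVec, mul_pow]
    exact ha.mul_of_nonneg hb (fun _ => by positivity) (fun _ => by positivity)
  have hs := isSchmidt_tsum (key u u' h.left h'.left) (key v v' h.right h'.right)
  convert hs
  refine ext_of_inner_prodVec fun f g f' g' => ?_
  refine HasSum.unique ?_ (hs.hasSum _ _)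
  rw [tensorOp_prodVec, inner_prodVec]
  have hm := summable_mul_of_summable_norm (h.hasSum f f').summable.norm
    (h'.hasSum g g').summable.norm
  refine ((h.hasSum f f').mul (h'.hasSum g g') hm).congr_fun fun p => ?_
  rw [inner_prodVec, inner_prodVec]
  ring

lemma IsSchmidt.opTrace_tensorOp {ι κ : Type*} {T S : Modes m →L[ℂ] Modes m} {u v : ι → Modes m}
    {u' v' : κ → Modes m} (h : IsSchmidt T u v) (h' : IsSchmidt S u' v') :
    opTrace (tensorOp T S) = opTrace T * opTrace S := by
  have hs : Summable fun k => ‖⟪v k, u k⟫_ℂ‖ :=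
    Summable.of_nonneg_of_le (fun _ => norm_nonneg _) (fun _ => norm_inner_le_norm _ _)
      (summable_norm_mul_norm h.right h.left)
  have hs' : Summable fun k => ‖⟪v' k, u' k⟫_ℂ‖ :=
    Summable.of_nonneg_of_le (fun _ => norm_nonneg _) (fun _ => norm_inner_le_norm _ _)
      (summable_norm_mul_norm h'.right h'.left)
  rw [(h.tensor h').opTrace_eq, h.opTrace_eq, h'.opTrace_eq,
    tsum_mul_tsum_of_summable_norm hs hs']
  simp only [inner_prodVec]

end TensorOperators

/-! ### The partial trace -/

section PartialTrace

variable {m : ℕ} {ι : Type*} {W : TwoModes m →L[ℂ] TwoModes m} {u v : ι → TwoModes m}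

lemma summable_adjoint_tensorRight (hu : Summable fun k => ‖u k‖ ^ 2) :
    Summable fun p : ι × basisIndex (Modes m) =>
      ‖(tensorRight (stdBasis (Modes m) p.2)).adjoint (u p.1)‖ ^ 2 := by
  have hs := hasSum_norm_sq_adjoint_tensorRight (stdBasis (Modes m))
  refine (summable_prod_of_nonneg fun p => by positivity).2 ⟨fun k => (hs (u k)).summable, ?_⟩
  simpa only [(hs _).tsum_eq] using hu

/-- The series defining the partial trace of a trace-class operator converges in operator norm. -/
lemma IsSchmidt.summable_partialTrace (h : IsSchmidt W u v) :
    Summable fun j => (tensorRight (stdBasis (Modes m) j)).adjoint ∘L W ∘L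
      tensorRight (stdBasis (Modes m) j) := by
  have hs := summable_norm_mul_norm (summable_adjoint_tensorRight h.left)
    (summable_adjoint_tensorRight h.right)
  have hs' := ((Equiv.prodComm _ ι).summable_iff.2 hs).prod
  refine Summable.of_norm_bounded hs' fun j => ?_
  exact (h.conj (tensorRight (stdBasis (Modes m) j)).adjoint
    (tensorRight (stdBasis (Modes m) j))).norm_le

/-- The partial trace of `∑ₖ |uₖ⟩⟨vₖ|` is the sum of `|⟨eⱼ|uₖ⟩⟩⟨⟨eⱼ|vₖ⟩|` over `j` and `k`, where
`⟨eⱼ|uₖ⟩` is the partial inner product over the modes `B`. -/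
lemma IsSchmidt.trB (h : IsSchmidt W u v) :
    IsSchmidt (partialTrace W)
      (fun p : ι × basisIndex (Modes m) =>
        (tensorRight (stdBasis (Modes m) p.2)).adjoint (u p.1))
      (fun p => (tensorRight (stdBasis (Modes m) p.2)).adjoint (v p.1)) := by
  have hs := isSchmidt_tsum (summable_adjoint_tensorRight h.left)
    (summable_adjoint_tensorRight h.right)
  convert hs
  refine clm_ext_inner fun f g => ?_
  have h1 := ((innerSL ℂ g).comp (ContinuousLinearMap.apply ℂ _ f)).hasSum
    h.summable_partialTrace.hasSum
  refine h1.unique ?_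
  refine ((Equiv.prodComm _ ι).hasSum_iff.2 (hs.hasSum f g)).prod_fiberwise fun j => ?_
  exact (h.conj (tensorRight (stdBasis (Modes m) j)).adjoint
    (tensorRight (stdBasis (Modes m) j))).hasSum f g

/-- The defining property of the partial trace: `tr (A tr_B W) = tr ((A ⊗ 1) W)`. -/
lemma IsSchmidt.opTrace_mul_partialTrace (h : IsSchmidt W u v) (A : Modes m →L[ℂ] Modes m) :
    opTrace (A * partialTrace W) = opTrace (tensorOp A 1 * W) := by
  have h1 := h.trB.mul_left A
  rw [h1.opTrace_eq, (h.mul_left _).opTrace_eq]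
  have hs : Summable fun p : ι × basisIndex (Modes m) =>
      ⟪(tensorRight (stdBasis (Modes m) p.2)).adjoint (v p.1),
        A ((tensorRight (stdBasis (Modes m) p.2)).adjoint (u p.1))⟫_ℂ :=
    Summable.of_norm_bounded (summable_norm_mul_norm h1.right h1.left) fun p =>
      norm_inner_le_norm _ _
  refine (hs.hasSum.prod_fiberwise fun k => ?_).tsum_eq.symm
  simpa only [adjoint_tensorRight_tensorOp] using
    hasSum_inner_adjoint_tensorRight (stdBasis (Modes m)) (v k) (tensorOp A 1 (u k))

/-- Cyclicity of the partial trace in the traced-out factor. -/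
lemma IsSchmidt.partialTrace_mul_comm (h : IsSchmidt W u v) (B : Modes m →L[ℂ] Modes m) :
    partialTrace (W * tensorOp 1 B) = partialTrace (tensorOp 1 B * W) := by
  have h1 := h.mul_right (tensorOp 1 B)
  have h2 := h.mul_left (tensorOp 1 B)
  refine h1.trB.ext_opTrace h2.trB fun A => ?_
  have hAB : tensorOp 1 B * tensorOp A 1 = tensorOp A 1 * tensorOp 1 B := by
    simp only [tensorOp_mul, one_mul, mul_one]
  calc opTrace (A * partialTrace (W * tensorOp 1 B))
      = opTrace ((tensorOp A 1 * W) * tensorOp 1 B) := by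
        rw [h1.opTrace_mul_partialTrace, mul_assoc]
    _ = opTrace (tensorOp 1 B * (tensorOp A 1 * W)) := ((h.mul_left _).opTrace_mul_comm _).symm
    _ = opTrace (tensorOp A 1 * (tensorOp 1 B * W)) := by
        rw [← mul_assoc, hAB, mul_assoc]
    _ = _ := (h2.opTrace_mul_partialTrace A).symm

/-- Operators on the modes `A` can be moved through the partial trace over the modes `B`. -/
lemma IsSchmidt.mul_partialTrace_mul (h : IsSchmidt W u v) (A B : Modes m →L[ℂ] Modes m) :
    A * partialTrace W * B =
      partialTrace (tensorOp A 1 * W * tensorOp B 1) := by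
  have h1 := (h.mul_left (tensorOp A 1)).mul_right (tensorOp B 1)
  refine ((h.trB.mul_left A).mul_right B).ext_opTrace h1.trB fun C => ?_
  calc opTrace (C * (A * partialTrace W * B))
      = opTrace ((C * A) * partialTrace W * B) := by simp only [mul_assoc]
    _ = opTrace (B * ((C * A) * partialTrace W)) := ((h.trB.mul_left _).opTrace_mul_comm _).symm
    _ = opTrace (tensorOp (B * (C * A)) 1 * W) := by
        rw [← mul_assoc, h.opTrace_mul_partialTrace]
    _ = opTrace (tensorOp B 1 * (tensorOp C 1 * (tensorOp A 1 * W))) := by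
        simp only [← mul_assoc, tensorOp_mul, one_mul]
    _ = opTrace ((tensorOp C 1 * (tensorOp A 1 * W)) * tensorOp B 1) :=
        ((h.mul_left _).mul_left _).opTrace_mul_comm _
    _ = _ := by rw [h1.opTrace_mul_partialTrace]; simp only [mul_assoc]

lemma IsSchmidt.opTrace_partialTrace (h : IsSchmidt W u v) :
    opTrace (partialTrace W) = opTrace W := by
  have := h.opTrace_mul_partialTrace 1
  rwa [tensorOp_one_one, one_mul, one_mul] at this

end PartialTrace

/-! ### Fourier analysis of trace-class operators on `L²(V)` -/

section Uniqueness

variable {V : Type*} [NormedAddCommGroup V] [NormedSpace ℝ V] [MeasurableSpace V] [BorelSpace V]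
  {μ : Measure V}

lemma integrable_exp_mul (L : StrongDual ℝ V) {h : V → ℂ} (hh : Integrable h μ) :
    Integrable (fun q => Complex.exp (L q * Complex.I) * h q) μ :=
  hh.bdd_mul (c := 1) (by fun_prop)
    (Filter.Eventually.of_forall fun q => (Complex.norm_exp_ofReal_mul_I _).le)

variable [CompleteSpace V] [SecondCountableTopology V]

lemma ae_eq_zero_of_integral_exp_ofReal {h : V → ℝ} (hh : Integrable h μ)
    (h0 : ∀ L : StrongDual ℝ V, ∫ q, Complex.exp (L q * Complex.I) * (h q : ℂ) ∂μ = 0) :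
    h =ᵐ[μ] 0 := by
  -- The positive and the negative part of `h` are the densities of two finite measures with the
  -- same characteristic function.
  have hm : ∀ g : V → ℝ, Integrable g μ → AEMeasurable (fun q => ENNReal.ofReal (g q)) μ :=
    fun g hg => hg.aestronglyMeasurable.aemeasurable.ennreal_ofReal
  have hfin : ∀ g : V → ℝ, Integrable g μ →
      IsFiniteMeasure (μ.withDensity fun q => ENNReal.ofReal (g q)) := fun g hg =>
    isFiniteMeasure_withDensity_ofReal hg.2
  have := hfin h hh
  have := hfin _ hh.neg
  have hint : ∀ (g : V → ℝ), Integrable g μ → ∀ L : StrongDual ℝ V,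
      charFunDual (μ.withDensity fun q => ENNReal.ofReal (g q)) L =
        ∫ q, Complex.exp (L q * Complex.I) * ((max (g q) 0 : ℝ) : ℂ) ∂μ := by
    intro g hg L
    rw [charFunDual_apply, integral_withDensity_eq_integral_toReal_smul₀ (hm g hg)
      (Filter.Eventually.of_forall fun q => ENNReal.ofReal_lt_top)]
    refine integral_congr_ae (Filter.Eventually.of_forall fun q => ?_)
    simp only [ENNReal.toReal_ofReal', Complex.real_smul]
    ring
  have heq : (μ.withDensity fun q => ENNReal.ofReal (h q)) =
      μ.withDensity fun q => ENNReal.ofReal ((-h) q) := by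
    refine Measure.ext_of_charFunDual (funext fun L => ?_)
    rw [hint h hh, hint _ hh.neg, ← sub_eq_zero, ← integral_sub]
    · rw [← h0 L]
      refine integral_congr_ae (Filter.Eventually.of_forall fun q => ?_)
      simp only [← mul_sub, Pi.neg_apply, ← Complex.ofReal_sub]
      congr 2
      rcases le_total (h q) 0 with hq | hq
      · rw [max_eq_right hq, max_eq_left (by linarith)]; ring
      · rw [max_eq_left hq, max_eq_right (by linarith)]; ring
    · exact integrable_exp_mul L (hh.pos_part.ofReal)
    · exact integrable_exp_mul L (hh.neg.pos_part.ofReal)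
  rw [withDensity_eq_iff (hm h hh) (hm _ hh.neg)] at heq
  · filter_upwards [heq] with q hq
    rw [Pi.neg_apply] at hq
    rcases le_total (h q) 0 with h1 | h1
    · rw [ENNReal.ofReal_of_nonpos h1, eq_comm, ENNReal.ofReal_eq_zero] at hq
      exact le_antisymm h1 (neg_nonpos.1 hq)
    · rw [ENNReal.ofReal_of_nonpos (by linarith : -h q ≤ 0), ENNReal.ofReal_eq_zero] at hq
      exact le_antisymm hq h1
  · exact hh.lintegral_lt_top.ne

/-- Injectivity of the Fourier transform on `L¹`. -/
lemma ae_eq_zero_of_integral_exp {h : V → ℂ} (hh : Integrable h μ)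
    (h0 : ∀ L : StrongDual ℝ V, ∫ q, Complex.exp (L q * Complex.I) * h q ∂μ = 0) :
    h =ᵐ[μ] 0 := by
  have hconj : ∀ L : StrongDual ℝ V,
      ∫ q, Complex.exp (L q * Complex.I) * (starRingEnd ℂ) (h q) ∂μ = 0 := by
    intro L
    rw [← map_zero (starRingEnd ℂ), ← h0 (-L), ← integral_conj]
    refine integral_congr_ae (Filter.Eventually.of_forall fun q => ?_)
    simp [← Complex.exp_conj]
  have hcint : Integrable (fun q => (starRingEnd ℂ) (h q)) μ :=
    Complex.conjLIE.integrable_comp_iff.2 hh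
  have hre := ae_eq_zero_of_integral_exp_ofReal hh.re fun L => by
    have : ∀ q, Complex.exp (L q * Complex.I) * ((RCLike.re (h q) : ℝ) : ℂ) =
        (Complex.exp (L q * Complex.I) * h q +
          Complex.exp (L q * Complex.I) * (starRingEnd ℂ) (h q)) * (1 / 2) := fun q => by
      have := Complex.add_conj (h q)
      simp only [RCLike.re_to_complex]
      push_cast at this
      linear_combination (-1 / 2 : ℂ) * Complex.exp (L q * Complex.I) * this
    simp only [this]
    rw [integral_mul_const, integral_add (integrable_exp_mul L hh) (integrable_exp_mul L hcint),
      h0, hconj]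
    simp
  have him := ae_eq_zero_of_integral_exp_ofReal hh.im fun L => by
    have : ∀ q, Complex.exp (L q * Complex.I) * ((RCLike.im (h q) : ℝ) : ℂ) =
        (Complex.exp (L q * Complex.I) * h q -
          Complex.exp (L q * Complex.I) * (starRingEnd ℂ) (h q)) * (1 / (2 * Complex.I)) :=
        fun q => by
      have := Complex.sub_conj (h q)
      simp only [RCLike.im_to_complex]
      field_simp
      push_cast at this
      linear_combination (-1 : ℂ) * this
    simp only [this]
    rw [integral_mul_const, integral_sub (integrable_exp_mul L hh) (integrable_exp_mul L hcint),
      h0, hconj]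
    simp
  filter_upwards [hre, him] with q h1 h2
  exact Complex.ext h1 h2

/-- If the Fourier transform of `∑ₖ aₖ` vanishes, then so do the integrals of `∑ₖ aₖ` against all
bounded functions. -/
lemma tsum_integral_mul_eq_zero {ι : Type*} {a : ι → V → ℂ} (ha : ∀ k, Integrable (a k) μ)
    (hs : Summable fun k => ∫ q, ‖a k q‖ ∂μ)
    (h0 : ∀ L : StrongDual ℝ V, ∑' k, ∫ q, Complex.exp (L q * Complex.I) * a k q ∂μ = 0)
    {φ : V → ℂ} (hφ : MemLp φ ⊤ μ) : ∑' k, ∫ q, φ q * a k q ∂μ = 0 := by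
  have hA : Summable fun k => (ha k).toL1 (a k) := by
    refine Summable.of_norm (hs.congr fun k => ?_)
    rw [L1.norm_of_fun_eq_integral_norm]
  -- The series `∑ₖ aₖ` converges in `L¹`, and integration against `θ` is continuous there.
  have hpair : ∀ {θ : V → ℂ}, MemLp θ ⊤ μ →
      ∑' k, ∫ q, θ q * a k q ∂μ = ∫ q, θ q * (∑' k, (ha k).toL1 (a k) : Lp ℂ 1 μ) q ∂μ := by
    intro θ hθ
    have h := ((ContinuousLinearMap.lpPairing μ ⊤ 1 (ContinuousLinearMap.mul ℂ ℂ))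
      (hθ.toLp θ)).hasSum hA.hasSum
    simp only [ContinuousLinearMap.lpPairing_eq_integral,
      ContinuousLinearMap.mul_apply'] at h
    refine (tsum_congr fun k => ?_).trans (h.tsum_eq.trans ?_)
    · refine integral_congr_ae ?_
      filter_upwards [hθ.coeFn_toLp, (ha k).coeFn_toL1] with q h1 h2
      rw [h1, h2]
    · refine integral_congr_ae ?_
      filter_upwards [hθ.coeFn_toLp] with q h1
      rw [h1]
  have hH := ae_eq_zero_of_integral_exp (L1.integrable_coeFn (∑' k, (ha k).toL1 (a k))) fun L => by
    rw [← hpair, h0]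
    exact memLp_top_of_bound (by fun_prop) 1
      (Filter.Eventually.of_forall fun q => (Complex.norm_exp_ofReal_mul_I _).le)
  rw [hpair hφ]
  refine integral_eq_zero_of_ae ?_
  filter_upwards [hH] with q hq
  rw [hq]; simp

lemma integral_norm_mul_norm_le {α : Type*} [MeasurableSpace α] {μ : Measure α}
    (f g : Lp ℂ 2 μ) : ∫ q, ‖f q‖ * ‖g q‖ ∂μ ≤ ‖f‖ * ‖g‖ := by
  have hsq : ∀ w : Lp ℂ 2 μ, (∫ q, ‖w q‖ ^ (2 : ℝ) ∂μ) ^ (1 / 2 : ℝ) = ‖w‖ := by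
    intro w
    have h1 : ∫ q, ‖w q‖ ^ (2 : ℝ) ∂μ = ‖w‖ ^ 2 := by
      have h2 := inner_self_eq_norm_sq_to_K (𝕜 := ℂ) w
      rw [L2.inner_def] at h2
      simp only [inner_self_eq_norm_sq_to_K, Complex.coe_algebraMap,
        ← Complex.ofReal_pow, integral_complex_ofReal] at h2
      simpa using Complex.ofReal_injective h2
    rw [h1, ← Real.sqrt_eq_rpow, Real.sqrt_sq (norm_nonneg _)]
  have h := integral_mul_norm_le_Lp_mul_Lq (μ := μ) (f := f) (g := g)
    Real.HolderConjugate.two_two (by simpa using Lp.memLp f) (by simpa using Lp.memLp g)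
  rwa [hsq, hsq] at h

/-- The bounded functions are dense in `L²`. -/
lemma forall_inner_eq_zero_of_memLp_top {α : Type*} [MeasurableSpace α] {μ : Measure α}
    {w : Lp ℂ 2 μ} (h : ∀ g : Lp ℂ 2 μ, MemLp g ⊤ μ → ⟪g, w⟫_ℂ = 0) : w = 0 := by
  refine ext_inner_left ℂ fun g => ?_
  rw [inner_zero_right]
  induction g using Lp.induction (p := 2) ENNReal.ofNat_ne_top with
  | indicatorConst c hs hμs =>
    refine h _ ((memLp_indicator_const ⊤ hs c (Or.inr hμs.ne)).ae_eq ?_)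
    rw [Lp.simpleFunc.coe_indicatorConst]
    exact indicatorConstLp_coeFn.symm
  | add hf hg hd h1 h2 => rw [inner_add_left, h1, h2, add_zero]
  | isClosed => exact isClosed_eq (by fun_prop) continuous_const

/-- Characteristic functions determine trace-class operators on `L²(V)`. For a fixed shift `α` the
hypothesis says that the Fourier transform of `q ↦ ∑ₖ conj (vₖ q) uₖ (q + α)` vanishes; these
functions are the diagonals of the integral kernel of `T`. -/
theorem IsSchmidt.eq_zero_of_fourier [SFinite μ] [μ.IsAddLeftInvariant]
    {ι : Type*} [Countable ι] {T : Lp ℂ 2 μ →L[ℂ] Lp ℂ 2 μ} {u v : ι → Lp ℂ 2 μ}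
    (h : IsSchmidt T u v)
    (h0 : ∀ (α : V) (L : StrongDual ℝ V), ∑' k, ∫ q, Complex.exp (L q * Complex.I) *
      ((starRingEnd ℂ) (v k q) * u k (q + α)) ∂μ = 0) : T = 0 := by
  have hmp : ∀ α : V, MeasurePreserving (fun q => q + α) μ μ := measurePreserving_add_right μ
  have ha : ∀ α k, Integrable (fun q => (starRingEnd ℂ) (v k q) * u k (q + α)) μ := fun α k =>
    (Lp.memLp (v k)).star.integrable_mul ((Lp.memLp (u k)).comp_measurePreserving (hmp α))
  have hs : ∀ α, Summable fun k => ∫ q, ‖(starRingEnd ℂ) (v k q) * u k (q + α)‖ ∂μ := by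
    intro α
    refine Summable.of_nonneg_of_le (fun k => integral_nonneg fun q => norm_nonneg _) (fun k => ?_)
      (summable_norm_mul_norm h.right h.left)
    rw [← Lp.norm_compMeasurePreserving (u k) (hmp α)]
    refine le_trans (le_of_eq (integral_congr_ae ?_)) (integral_norm_mul_norm_le _ _)
    filter_upwards [Lp.coeFn_compMeasurePreserving (u k) (hmp α)] with q hq
    rw [hq, norm_mul, RCLike.norm_conj, Function.comp_apply]
  -- It suffices to consider matrix elements between bounded functions `f` and `g`; these are
  -- integrals over all shifts `α` of bounded functions times the diagonals of the kernel.
  suffices key : ∀ f g : Lp ℂ 2 μ, MemLp f ⊤ μ → MemLp g ⊤ μ → ⟪g, T f⟫_ℂ = 0 by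
    have hadj : T.adjoint = 0 := ContinuousLinearMap.ext fun g =>
      forall_inner_eq_zero_of_memLp_top fun f hf => by
        rw [ContinuousLinearMap.adjoint_inner_right, ← inner_conj_symm,
          forall_inner_eq_zero_of_memLp_top fun g' hg' => key f g' hf hg', inner_zero_right,
          map_zero]
    rw [← ContinuousLinearMap.adjoint_adjoint T, hadj, map_zero]
  intro f g hf hg
  have hφ : ∀ α, MemLp (fun q => (starRingEnd ℂ) (g (q + α)) * f q) ⊤ μ := fun α =>
    hf.mul (hg.comp_measurePreserving (hmp α)).star
  have hzero : ∀ α, ∑' k, ∫ q, ((starRingEnd ℂ) (g (q + α)) * f q) *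
      ((starRingEnd ℂ) (v k q) * u k (q + α)) ∂μ = 0 := fun α =>
    tsum_integral_mul_eq_zero (ha α) (hs α) (h0 α) (hφ α)
  have hint : ∀ w w' : Lp ℂ 2 μ, Integrable (fun q => (starRingEnd ℂ) (w q) * w' q) μ :=
    fun w w' => (Lp.memLp w).star.integrable_mul (Lp.memLp w')
  have hinner : ∀ w w' : Lp ℂ 2 μ, ∫ q, (starRingEnd ℂ) (w q) * w' q ∂μ = ⟪w, w'⟫_ℂ := by
    intro w w'
    rw [L2.inner_def]
    simp only [RCLike.inner_apply, mul_comm]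
  have hshear := measurePreserving_prod_add μ μ
  have hemb : MeasurableEmbedding fun z : V × V => (z.1, z.1 + z.2) :=
    (MeasurableEquiv.shearAddRight V).measurableEmbedding
  have hb : ∀ k, Integrable (fun z : V × V => ((starRingEnd ℂ) (g (z.1 + z.2)) * f z.1) *
      ((starRingEnd ℂ) (v k z.1) * u k (z.1 + z.2))) (μ.prod μ) := by
    intro k
    have := hshear.integrable_comp_of_integrable ((hint (v k) f).mul_prod (hint g (u k)))
    refine this.congr (Filter.Eventually.of_forall fun z => ?_)
    simp only [Function.comp_apply]
    ring
  -- Fubini, after the change of variables `(q, α) ↦ (q, q + α)`.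
  have hval : ∀ k, ∫ α, ∫ q, ((starRingEnd ℂ) (g (q + α)) * f q) *
      ((starRingEnd ℂ) (v k q) * u k (q + α)) ∂μ ∂μ = ⟪g, u k⟫_ℂ * ⟪v k, f⟫_ℂ := by
    intro k
    rw [← integral_prod_symm _ (hb k), ← hinner, ← hinner, mul_comm, ← integral_prod_mul,
      ← hshear.integral_comp hemb fun z : V × V => ((starRingEnd ℂ) (v k z.1) * f z.1) *
        ((starRingEnd ℂ) (g z.2) * u k z.2)]
    refine integral_congr_ae (Filter.Eventually.of_forall fun z => ?_)
    simp only
    ring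
  have hsum : Summable fun k => ∫ α, ‖∫ q, ((starRingEnd ℂ) (g (q + α)) * f q) *
      ((starRingEnd ℂ) (v k q) * u k (q + α)) ∂μ‖ ∂μ := by
    refine Summable.of_nonneg_of_le (fun k => integral_nonneg fun q => norm_nonneg _) (fun k => ?_)
      ((summable_norm_mul_norm h.right h.left).mul_left (‖f‖ * ‖g‖))
    calc ∫ α, ‖∫ q, ((starRingEnd ℂ) (g (q + α)) * f q) *
          ((starRingEnd ℂ) (v k q) * u k (q + α)) ∂μ‖ ∂μ
        ≤ ∫ α, ∫ q, ‖((starRingEnd ℂ) (g (q + α)) * f q) *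
          ((starRingEnd ℂ) (v k q) * u k (q + α))‖ ∂μ ∂μ :=
          integral_mono (hb k).integral_prod_right.norm (hb k).norm.integral_prod_right
            fun α => norm_integral_le_integral_norm _
      _ = (∫ q, ‖v k q‖ * ‖f q‖ ∂μ) * ∫ q, ‖g q‖ * ‖u k q‖ ∂μ := by
          rw [← integral_prod_symm _ (hb k).norm, ← integral_prod_mul,
            ← hshear.integral_comp hemb fun z : V × V => (‖v k z.1‖ * ‖f z.1‖) *
              (‖g z.2‖ * ‖u k z.2‖)]
          refine integral_congr_ae (Filter.Eventually.of_forall fun z => ?_)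
          simp only [norm_mul, RCLike.norm_conj]
          ring
      _ ≤ (‖v k‖ * ‖f‖) * (‖g‖ * ‖u k‖) :=
          mul_le_mul (integral_norm_mul_norm_le _ _) (integral_norm_mul_norm_le _ _)
            (integral_nonneg fun q => by positivity) (by positivity)
      _ = ‖f‖ * ‖g‖ * (‖v k‖ * ‖u k‖) := by ring
  have hlim := hasSum_integral_of_summable_integral_norm
    (fun k => (hb k).integral_prod_right) hsum
  simp only [hzero, hval, integral_zero] at hlim
  exact (h.hasSum f g).unique hlim

/-- A trace-class operator `T` on `L²(V)` vanishes if `tr (W T) = 0` for operators `W` running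
through all products of a shift and a character, each up to a nonzero factor. -/
theorem IsSchmidt.eq_zero_of_opTrace_shift [SFinite μ] [μ.IsAddLeftInvariant]
    {ι : Type*} {T : Lp ℂ 2 μ →L[ℂ] Lp ℂ 2 μ} {u v : ι → Lp ℂ 2 μ} (h : IsSchmidt T u v)
    (h0 : ∀ (α : V) (L : StrongDual ℝ V), ∃ (W : Lp ℂ 2 μ →L[ℂ] Lp ℂ 2 μ) (c : ℂ), c ≠ 0 ∧
      (∀ ψ, W ψ =ᵐ[μ] fun q => c * (Complex.exp (L q * Complex.I) * ψ (q + α))) ∧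
      opTrace (W * T) = 0) : T = 0 := by
  have := h.left.countable_support.to_subtype
  refine h.restrict.eq_zero_of_fourier fun α L => ?_
  obtain ⟨W, c, hc, hW, hT⟩ := h0 α L
  rw [(h.restrict.mul_left W).opTrace_eq] at hT
  refine (mul_eq_zero.1 ?_).resolve_left hc
  rw [← tsum_mul_left, ← hT]
  refine tsum_congr fun k => ?_
  rw [L2.inner_def, ← integral_const_mul]
  refine integral_congr_ae ?_
  filter_upwards [hW (u k)] with q hq
  rw [hq, RCLike.inner_apply]
  ring

end Uniqueness

/-! ### Displacement operators and characteristic functions -/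

section Weyl

variable {m : ℕ}

lemma weyl_zero : weyl (0 : Phase m) = 1 := by
  refine ContinuousLinearMap.ext fun ψ => Lp.ext ?_
  filter_upwards [weyl_apply 0 ψ] with q hq
  rw [hq]
  have h1 : weylPhase (0 : Phase m) q = 1 := by simp [weylPhase]
  have h2 : (fun j => (0 : Phase m) (j, 1)) = (0 : Fin m → ℝ) := rfl
  rw [h1, one_mul, h2, add_zero]
  rfl

/-- The shift in position produced by the displacement operator `D_r`. -/
def phaseShift (r : Phase m) : Fin m → ℝ := fun j => r (j, 1)

/-- The tensor product of the displacement operators `D_r` and `D_s`, as a shift followed by the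
multiplication with a phase. -/
lemma tensorOp_weyl_apply (r s : Phase m) (ψ : TwoModes m) :
    tensorOp (weyl r) (weyl s) ψ =ᵐ[volume] fun z =>
      weylPhase r z.1 * weylPhase s z.2 * ψ (z + (phaseShift r, phaseShift s)) := by
  have hmp : MeasurePreserving
      (fun z : (Fin m → ℝ) × (Fin m → ℝ) => z + (phaseShift r, phaseShift s)) volume volume :=
    (measurePreserving_shift r).prod (measurePreserving_shift s)
  have hφ : MemLp (fun z : (Fin m → ℝ) × (Fin m → ℝ) => weylPhase r z.1 * weylPhase s z.2) ⊤
      volume :=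
    memLp_top_of_bound (((continuous_weylPhase r).comp continuous_fst).mul
      ((continuous_weylPhase s).comp continuous_snd)).aestronglyMeasurable 1
      (Filter.Eventually.of_forall fun z => by simp [norm_weylPhase])
  -- `M` has the claimed form on all of `L²` by construction, and agrees with `D_r ⊗ D_s` on product
  -- vectors.
  set M : TwoModes m →L[ℂ] TwoModes m :=
    (ContinuousLinearMap.mul ℂ ℂ).holderL volume ⊤ 2 2 (hφ.toLp _) ∘L
      (Lp.compMeasurePreservingₗᵢ ℂ _ hmp).toContinuousLinearMap with hM
  have hMψ : ∀ ψ : TwoModes m, M ψ =ᵐ[volume] fun z =>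
      weylPhase r z.1 * weylPhase s z.2 * ψ (z + (phaseShift r, phaseShift s)) := by
    intro ψ
    have h1 := (ContinuousLinearMap.mul ℂ ℂ).coeFn_holder (r := 2) (hφ.toLp _)
      (Lp.compMeasurePreserving _ hmp ψ)
    have h2 := Lp.coeFn_compMeasurePreserving ψ hmp
    filter_upwards [h1, h2, hφ.coeFn_toLp] with z h1 h2 h3
    refine h1.trans ?_
    rw [h3, h2]
    rfl
  have : tensorOp (weyl r) (weyl s) = M := ext_of_prodVec fun f g => by
    rw [tensorOp_prodVec]
    refine Lp.ext ?_
    filter_upwards [hMψ (prodVec f g), coeFn_prodVec (weyl r f) (weyl s g), ae_fst (weyl_apply r f),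
      ae_snd (weyl_apply s g), hmp.quasiMeasurePreserving.ae (coeFn_prodVec f g)] with z h1 h2 h3 h4 h5
    rw [h1, h2, h3, h4, h5]
    have hs : ∀ t : Phase m, phaseShift t = fun j => t (j, 1) := fun _ => rfl
    simp only [Prod.fst_add, Prod.snd_add, hs]
    ring
  rw [this]
  exact hMψ ψ

lemma strongDual_pi_apply (L : StrongDual ℝ (Fin m → ℝ)) (q : Fin m → ℝ) :
    L q = ∑ j, L (Pi.single j 1) * q j := by
  conv_lhs => rw [pi_eq_sum_univ' q]
  simp only [map_sum, map_smul, smul_eq_mul]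
  refine Finset.sum_congr rfl fun j _ => ?_
  rw [mul_comm]

/-- The phase-space point whose displacement operator is the shift by `α` followed by the
multiplication with `exp (i L)`, up to a phase factor. -/
def dualPhase (L : StrongDual ℝ (Fin m → ℝ)) (α : Fin m → ℝ) : Phase m :=
  fun p => if p.2 = 0 then L (Pi.single p.1 1) else α p.1

lemma weylPhase_dualPhase (L : StrongDual ℝ (Fin m → ℝ)) (α q : Fin m → ℝ) :
    weylPhase (dualPhase L α) q =
      weylPhase (dualPhase L α) 0 * Complex.exp (L q * Complex.I) := by
  simp only [weylPhase, ← Complex.exp_add]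
  congr 1
  rw [strongDual_pi_apply L q]
  simp [dualPhase]
  ring

lemma phaseShift_dualPhase (L : StrongDual ℝ (Fin m → ℝ)) (α : Fin m → ℝ) :
    phaseShift (dualPhase L α) = α := by
  ext j; simp [phaseShift, dualPhase]

variable {ι κ : Type*}

/-- Trace-class operators with the same characteristic function are equal. -/
theorem IsSchmidt.eq_of_charFn {T S : Modes m →L[ℂ] Modes m} {u v : ι → Modes m}
    {u' v' : κ → Modes m} (h : IsSchmidt T u v) (h' : IsSchmidt S u' v')
    (hTS : ∀ r, charFn T r = charFn S r) : T = S := by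
  have hD := h.add h'.neg
  rw [← sub_eq_add_neg] at hD
  refine sub_eq_zero.1 (hD.eq_zero_of_opTrace_shift fun α L => ?_)
  refine ⟨weyl (dualPhase L α), weylPhase (dualPhase L α) 0,
    norm_ne_zero_iff.1 (by simp [norm_weylPhase]), fun ψ => ?_, ?_⟩
  · filter_upwards [weyl_apply (dualPhase L α) ψ] with q hq
    rw [hq, weylPhase_dualPhase, mul_assoc]
    congr 4
  · rw [mul_sub, (h.mul_left _).opTrace_sub (h'.mul_left _)]
    exact sub_eq_zero.2 (hTS _)

/-- The two-copy version of `IsSchmidt.eq_of_charFn`. -/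
theorem IsSchmidt.eq_of_opTrace_tensorOp_weyl {T S : TwoModes m →L[ℂ] TwoModes m}
    {u v : ι → TwoModes m} {u' v' : κ → TwoModes m} (h : IsSchmidt T u v) (h' : IsSchmidt S u' v')
    (hTS : ∀ r s, opTrace (tensorOp (weyl r) (weyl s) * T) =
      opTrace (tensorOp (weyl r) (weyl s) * S)) : T = S := by
  have hD := h.add h'.neg
  rw [← sub_eq_add_neg] at hD
  have : (volume : Measure ((Fin m → ℝ) × (Fin m → ℝ))).IsAddHaarMeasure :=
    Measure.prod.instIsAddHaarMeasure _ _
  refine sub_eq_zero.1 (hD.eq_zero_of_opTrace_shift fun α L => ?_)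
  let r := dualPhase (L.comp (.inl ℝ _ _)) α.1
  let s := dualPhase (L.comp (.inr ℝ _ _)) α.2
  refine ⟨tensorOp (weyl r) (weyl s), weylPhase r 0 * weylPhase s 0,
    norm_ne_zero_iff.1 (by simp [norm_weylPhase]), fun ψ => ?_, ?_⟩
  · filter_upwards [tensorOp_weyl_apply r s ψ] with z hz
    rw [hz, weylPhase_dualPhase _ _ z.1, weylPhase_dualPhase _ _ z.2, phaseShift_dualPhase,
      phaseShift_dualPhase]
    have hL : L z = L (z.1, 0) + L (0, z.2) := by rw [← map_add]; simp
    rw [hL]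
    simp only [ContinuousLinearMap.comp_apply, ContinuousLinearMap.inl_apply,
      ContinuousLinearMap.inr_apply, Complex.ofReal_add, add_mul, Complex.exp_add, r, s]
    ring
  · rw [mul_sub, (h.mul_left _).opTrace_sub (h'.mul_left _)]
    exact sub_eq_zero.2 (hTS _ _)

end Weyl

/-! ### Beam splitters acting on displacement operators -/

section BeamSplitterWeyl

variable {m : ℕ} (R : unitInterval)

lemma beamSplitter_apply (ψ : TwoModes m) :
    beamSplitter m R ψ =ᵐ[volume] fun z => ψ (rotation m R z) :=
  Lp.coeFn_compMeasurePreserving ψ (measurePreserving_rotation m R)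

lemma adjoint_beamSplitter_mul_self :
    (beamSplitter m R).adjoint * beamSplitter m R = 1 := by
  refine clm_ext_inner fun f g => ?_
  rw [mul_apply_eq_comp, ContinuousLinearMap.adjoint_inner_right]
  exact LinearIsometry.inner_map_map
    (Lp.compMeasurePreservingₗᵢ ℂ _ (measurePreserving_rotation m R)) g f

/-- Rotating the displacement vectors and the positions simultaneously preserves the sums of
products of coordinates in the exponent. -/
lemma weylPhase_rotation (r s : Phase m) (z : (Fin m → ℝ) × (Fin m → ℝ)) :
    weylPhase (√(1 - R : ℝ) • r - √(R : ℝ) • s) (rotation m R z).1 *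
      weylPhase (√(R : ℝ) • r + √(1 - R : ℝ) • s) (rotation m R z).2 =
      weylPhase r z.1 * weylPhase s z.2 := by
  have hR : √(R : ℝ) * √(R : ℝ) = R := Real.mul_self_sqrt R.2.1
  have hT : √(1 - R : ℝ) * √(1 - R : ℝ) = 1 - R := Real.mul_self_sqrt (sub_nonneg.2 R.2.2)
  simp only [weylPhase, ← Complex.exp_add, ← add_mul, ← Complex.ofReal_add]
  congr 3
  simp only [Finset.sum_div, ← Finset.sum_add_distrib]
  refine Finset.sum_congr rfl fun j _ => ?_
  simp only [rotation, LinearMap.coe_mk, AddHom.coe_mk, Pi.sub_apply, Pi.add_apply, Pi.smul_apply,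
    smul_eq_mul]
  linear_combination (r (j, 0) * z.1 j + s (j, 0) * z.2 j + r (j, 0) * r (j, 1) / 2 +
    s (j, 0) * s (j, 1) / 2) * (hR + hT)

/-- In the Heisenberg picture beam splitters rotate the displacement vectors. -/
lemma tensorOp_weyl_mul_beamSplitter (r s : Phase m) :
    tensorOp (weyl r) (weyl s) * beamSplitter m R =
      beamSplitter m R * tensorOp (weyl (√(1 - R : ℝ) • r - √(R : ℝ) • s))
        (weyl (√(R : ℝ) • r + √(1 - R : ℝ) • s)) := by
  have hmp : MeasurePreserving
      (fun z : (Fin m → ℝ) × (Fin m → ℝ) => z + (phaseShift r, phaseShift s)) volume volume :=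
    (measurePreserving_shift r).prod (measurePreserving_shift s)
  refine ContinuousLinearMap.ext fun ψ => Lp.ext ?_
  set r' := √(1 - R : ℝ) • r - √(R : ℝ) • s with hr'
  set s' := √(R : ℝ) • r + √(1 - R : ℝ) • s with hs'
  have hshift : (phaseShift r', phaseShift s') = rotation m R (phaseShift r, phaseShift s) := rfl
  filter_upwards [tensorOp_weyl_apply r s (beamSplitter m R ψ),
    hmp.quasiMeasurePreserving.ae (beamSplitter_apply R ψ),
    beamSplitter_apply R (tensorOp (weyl r') (weyl s') ψ),
    (measurePreserving_rotation m R).quasiMeasurePreserving.ae (tensorOp_weyl_apply r' s' ψ)]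
    with z h1 h2 h3 h4
  rw [mul_apply_eq_comp, mul_apply_eq_comp, h1, h2, h3, h4, weylPhase_rotation, hshift, map_add]

variable {ι : Type*} {S : TwoModes m →L[ℂ] TwoModes m} {u v : ι → TwoModes m}

lemma IsSchmidt.conj_beamSplitter (h : IsSchmidt S u v) :
    IsSchmidt (beamSplitter m R * S * (beamSplitter m R).adjoint)
      (fun i => beamSplitter m R (u i)) (fun i => beamSplitter m R (v i)) := by
  simpa only [ContinuousLinearMap.adjoint_adjoint] using
    (h.mul_left (beamSplitter m R)).mul_right (beamSplitter m R).adjoint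

/-- Beam splitters rotate the arguments of two-copy characteristic functions. -/
lemma IsSchmidt.opTrace_weyl_beamSplitter (h : IsSchmidt S u v) (r s : Phase m) :
    opTrace (tensorOp (weyl r) (weyl s) *
        (beamSplitter m R * S * (beamSplitter m R).adjoint)) =
      opTrace (tensorOp (weyl (√(1 - R : ℝ) • r - √(R : ℝ) • s))
        (weyl (√(R : ℝ) • r + √(1 - R : ℝ) • s)) * S) := by
  set U := beamSplitter m R
  set D := tensorOp (weyl (√(1 - R : ℝ) • r - √(R : ℝ) • s))
    (weyl (√(R : ℝ) • r + √(1 - R : ℝ) • s))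
  calc opTrace (tensorOp (weyl r) (weyl s) * (U * S * U.adjoint))
      = opTrace (tensorOp (weyl r) (weyl s) * U * S * U.adjoint) := by simp only [mul_assoc]
    _ = opTrace (U.adjoint * (tensorOp (weyl r) (weyl s) * U * S)) :=
        ((h.mul_left _).opTrace_mul_comm _).symm
    _ = opTrace ((U.adjoint * U) * (D * S)) := by
        rw [tensorOp_weyl_mul_beamSplitter]
        simp only [mul_assoc, U, D]
    _ = opTrace (D * S) := by rw [adjoint_beamSplitter_mul_self, one_mul]

lemma IsSchmidt.opTrace_conj_beamSplitter (h : IsSchmidt S u v) :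
    opTrace (beamSplitter m R * S * (beamSplitter m R).adjoint) = opTrace S := by
  rw [← (h.mul_left _).opTrace_mul_comm, ← mul_assoc, adjoint_beamSplitter_mul_self, one_mul]

end BeamSplitterWeyl

/-! ### Normalization and filtering of states -/

section States

variable {E : Type*} [NormedAddCommGroup E] [InnerProductSpace ℂ E] [CompleteSpace E]
  {ι : Type*} {T S : E →L[ℂ] E} {w : ι → E}

lemma IsDensity.isSchmidt {ρ : E →L[ℂ] E} (h : IsDensity ρ) :
    IsSchmidt ρ (fun i => opSqrt ρ (stdBasis E i)) (fun i => opSqrt ρ (stdBasis E i)) :=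
  isSchmidt_opSqrt h.1 h.2.1

lemma IsDensity.ne_zero {ρ : E →L[ℂ] E} (h : IsDensity ρ) : ρ ≠ 0 := by
  rintro rfl
  have := h.2.2
  simp [opTrace] at this

lemma IsSchmidt.isDensity_normalize (h : IsSchmidt T w w) (hT : T ≠ 0) :
    IsDensity (normalize T) := by
  have h0 : opTrace T ≠ 0 := fun h0 => hT (h.eq_zero_of_opTrace h0)
  set t : ℝ := ∑' k, ‖w k‖ ^ 2 with ht
  have hTt : opTrace T = t := h.opTrace_eq_norm
  have htn : 0 ≤ t := tsum_nonneg fun k => by positivity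
  -- The factor `1 / t` is split evenly between the two families, so that they stay equal.
  have key : IsSchmidt (normalize T) (fun i => ((√t⁻¹ : ℝ) : ℂ) • w i)
      (fun i => ((√t⁻¹ : ℝ) : ℂ) • w i) := by
    have h1 := (h.smul ((√t⁻¹ : ℝ) : ℂ)).mul_right (((√t⁻¹ : ℝ) : ℂ) • (1 : E →L[ℂ] E))
    convert h1 using 1
    · rw [normalize, hTt, mul_smul_comm, mul_one, smul_smul, ← Complex.ofReal_mul,
        Real.mul_self_sqrt (inv_nonneg.2 htn), Complex.ofReal_inv]
    · ext i
      rw [map_smulₛₗ, adjoint_one, Complex.conj_ofReal, smul_apply, one_apply_eq_self]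
  exact ⟨key.nonneg, key.isTraceClass, by
    rw [normalize, opTrace_smul, inv_mul_cancel₀ h0]⟩

lemma normalize_smul {c : ℂ} (hc : c ≠ 0) (T : E →L[ℂ] E) : normalize (c • T) = normalize T := by
  rw [normalize, normalize, opTrace_smul, smul_smul, mul_inv, mul_right_comm, inv_mul_cancel₀ hc,
    one_mul]

/-- Two-sided multiplication with an injective square root can be cancelled, since `√F` is
selfadjoint and hence has dense range. -/
lemma eq_zero_of_opSqrt_mul_mul {F A : E →L[ℂ] E} (hF : Function.Injective (opSqrt F))
    (h : opSqrt F * A * opSqrt F = 0) : A = 0 := by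
  have hcancel : ∀ B : E →L[ℂ] E, opSqrt F * B = 0 → B = 0 := fun B hB =>
    ContinuousLinearMap.ext fun x => hF <| by
      rw [← mul_apply_eq_comp, hB]; simp
  have h1 : A * opSqrt F = 0 := hcancel _ (by rw [← mul_assoc, h])
  have h2 : star A = 0 := hcancel _ <| by
    have := congrArg star h1
    rwa [star_mul, ContinuousLinearMap.star_eq_adjoint (opSqrt F), adjoint_opSqrt, star_zero]
      at this
  simpa using h2

lemma IsSchmidt.opSqrt_mul_mul (h : IsSchmidt T w w) (F : E →L[ℂ] E) :
    IsSchmidt (opSqrt F * T * opSqrt F) (fun i => opSqrt F (w i)) (fun i => opSqrt F (w i)) := by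
  simpa only [adjoint_opSqrt] using (h.mul_left (opSqrt F)).mul_right (opSqrt F)

end States

/-! ### Gaussian filters commute with beam splitters -/

section Filter

variable {m : ℕ} {F : Modes m →L[ℂ] Modes m}

lemma IsGaussianFilter.nonneg (hF : IsGaussianFilter F) : 0 ≤ F := by
  obtain ⟨-, c, hc, σ, Γ, hσ, rfl⟩ := hF
  exact smul_nonneg (by exact_mod_cast hc.le) hσ.1.1

lemma IsGaussianFilter.injective_opSqrt (hF : IsGaussianFilter F) :
    Function.Injective (opSqrt F) := by
  intro x y hxy
  apply hF.1
  rw [← opSqrt_mul_opSqrt hF.nonneg, mul_apply_eq_comp, mul_apply_eq_comp, hxy]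

variable (R : unitInterval)

/-- The exponent of a centred Gaussian characteristic function is a quadratic form, and the beam
splitters rotate its two arguments. -/
lemma quadratic_rotation (Γ : Matrix (Fin m × Fin 2) (Fin m × Fin 2) ℝ) (r s : Phase m) :
    (√(1 - R : ℝ) • r - √(R : ℝ) • s) ⬝ᵥ Γ.mulVec (√(1 - R : ℝ) • r - √(R : ℝ) • s) +
      (√(R : ℝ) • r + √(1 - R : ℝ) • s) ⬝ᵥ Γ.mulVec (√(R : ℝ) • r + √(1 - R : ℝ) • s) =
      r ⬝ᵥ Γ.mulVec r + s ⬝ᵥ Γ.mulVec s := by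
  have hR : √(R : ℝ) * √(R : ℝ) = R := Real.mul_self_sqrt R.2.1
  have hT : √(1 - R : ℝ) * √(1 - R : ℝ) = 1 - R := Real.mul_self_sqrt (sub_nonneg.2 R.2.2)
  simp only [Matrix.mulVec_sub, Matrix.mulVec_add, Matrix.mulVec_smul, sub_dotProduct,
    add_dotProduct, dotProduct_sub, dotProduct_add, smul_dotProduct, dotProduct_smul, smul_eq_mul]
  linear_combination (r ⬝ᵥ Γ.mulVec r + s ⬝ᵥ Γ.mulVec s) * (hR + hT)

lemma opTrace_weyl_mul_tensorOp {ι κ : Type*} {T S : Modes m →L[ℂ] Modes m} {u v : ι → Modes m}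
    {u' v' : κ → Modes m} (h : IsSchmidt T u v) (h' : IsSchmidt S u' v') (r s : Phase m) :
    opTrace (tensorOp (weyl r) (weyl s) * tensorOp T S) = charFn T r * charFn S s := by
  rw [tensorOp_mul, (h.mul_left _).opTrace_tensorOp (h'.mul_left _)]
  rfl

/-- Two copies of a centred Gaussian state are invariant under beam splitters. -/
lemma IsGaussianState.conj_beamSplitter {σ : Modes m →L[ℂ] Modes m}
    {Γ : Matrix (Fin m × Fin 2) (Fin m × Fin 2) ℝ} (h : IsGaussianState σ 0 Γ) :
    beamSplitter m R * tensorOp σ σ * (beamSplitter m R).adjoint = tensorOp σ σ := by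
  have hσ := h.1.isSchmidt
  have hσσ := hσ.tensor hσ
  refine (hσσ.conj_beamSplitter R).eq_of_opTrace_tensorOp_weyl hσσ fun r s => ?_
  rw [hσσ.opTrace_weyl_beamSplitter, opTrace_weyl_mul_tensorOp hσ hσ,
    opTrace_weyl_mul_tensorOp hσ hσ]
  simp only [h.2.2, ← Complex.exp_add]
  congr 1
  have := congrArg (fun x : ℝ => (x : ℂ)) (quadratic_rotation R Γ r s)
  simp only [Complex.ofReal_add] at this
  simp only [dotProduct_zero, Complex.ofReal_zero, mul_zero, zero_sub]
  linear_combination (-1 / 4 : ℂ) * this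

/-- `P ⊗ P` is invariant under beam splitters. The form `U (P ⊗ P) U† = P ⊗ P` yields both
commutation relations below from `U† U = 1` alone. -/
lemma IsGaussianFilter.conj_beamSplitter_opSqrt (hF : IsGaussianFilter F) :
    beamSplitter m R * tensorOp (opSqrt F) (opSqrt F) * (beamSplitter m R).adjoint =
      tensorOp (opSqrt F) (opSqrt F) := by
  have hFF : beamSplitter m R * tensorOp F F * (beamSplitter m R).adjoint = tensorOp F F := by
    obtain ⟨-, c, hc, σ, Γ, hσ, rfl⟩ := hF
    rw [tensorOp_smul_smul, mul_smul_comm, smul_mul_assoc, hσ.conj_beamSplitter]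
  set U := beamSplitter m R with hU
  set Q := tensorOp (opSqrt F) (opSqrt F) with hQ
  have hQ0 : 0 ≤ Q := tensorOp_nonneg (opSqrt_nonneg F) (opSqrt_nonneg F)
  have hQQ : Q * Q = tensorOp F F := by
    rw [hQ, tensorOp_mul, opSqrt_mul_opSqrt hF.nonneg]
  -- `P ⊗ P` and `U (P ⊗ P) U†` are both positive square roots of `F ⊗ F`.
  have h : opSqrt (tensorOp F F) = U * Q * U.adjoint := by
    refine opSqrt_eq_of_mul_self ?_ ?_
    · rw [← ContinuousLinearMap.star_eq_adjoint]
      exact star_right_conjugate_nonneg hQ0 U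
    · calc U * Q * U.adjoint * (U * Q * U.adjoint)
          = U * Q * (U.adjoint * U) * Q * U.adjoint := by simp only [mul_assoc]
        _ = U * (Q * Q) * U.adjoint := by
            rw [hU, adjoint_beamSplitter_mul_self, mul_one]; simp only [mul_assoc]
        _ = tensorOp F F := by rw [hQQ, hFF]
  rw [← h, opSqrt_eq_of_mul_self hQ0 hQQ]

lemma IsGaussianFilter.commute_beamSplitter (hF : IsGaussianFilter F) :
    tensorOp (opSqrt F) (opSqrt F) * beamSplitter m R =
      beamSplitter m R * tensorOp (opSqrt F) (opSqrt F) := by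
  conv_lhs => rw [← hF.conj_beamSplitter_opSqrt R]
  rw [mul_assoc, adjoint_beamSplitter_mul_self, mul_one]

lemma IsGaussianFilter.commute_adjoint_beamSplitter (hF : IsGaussianFilter F) :
    (beamSplitter m R).adjoint * tensorOp (opSqrt F) (opSqrt F) =
      tensorOp (opSqrt F) (opSqrt F) * (beamSplitter m R).adjoint := by
  conv_lhs => rw [← hF.conj_beamSplitter_opSqrt R]
  rw [← mul_assoc, ← mul_assoc, adjoint_beamSplitter_mul_self, one_mul]

end Filter

/-! ### Building blocks -/

section Blocks

variable {m : ℕ} {F ρA ρB : Modes m →L[ℂ] Modes m} (R : unitInterval)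

/-- Filtering only one output port, symmetrically: `tr_B [W (1 ⊗ F)] = tr_B [(1 ⊗ P) W (1 ⊗ P)]`. -/
lemma blockOp_eq_symmetric (hF : 0 ≤ F) (hA : IsDensity ρA) (hB : IsDensity ρB) :
    blockOp F R ρA ρB = partialTrace (tensorOp 1 (opSqrt F) *
      (beamSplitter m R * tensorOp ρA ρB * (beamSplitter m R).adjoint) *
      tensorOp 1 (opSqrt F)) := by
  have hW := (hA.isSchmidt.tensor hB.isSchmidt).conj_beamSplitter R
  rw [mul_assoc (tensorOp 1 (opSqrt F)), ← (hW.mul_right _).partialTrace_mul_comm, mul_assoc,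
    tensorOp_mul, one_mul, opSqrt_mul_opSqrt hF]
  rfl

/-- The unnormalized output of a building block is positive and trace class. -/
lemma exists_isSchmidt_blockOp (hF : 0 ≤ F) (hA : IsDensity ρA) (hB : IsDensity ρB) :
    ∃ (ι : Type) (w : ι → Modes m), IsSchmidt (blockOp F R ρA ρB) w w := by
  have hW := (hA.isSchmidt.tensor hB.isSchmidt).conj_beamSplitter R
  have h := ((hW.mul_left (tensorOp 1 (opSqrt F))).mul_right (tensorOp 1 (opSqrt F))).trB
  rw [adjoint_tensorOp, adjoint_opSqrt, adjoint_one,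
    ← blockOp_eq_symmetric R hF hA hB] at h
  exact ⟨_, _, h⟩

/-- The filters move through the beam splitters to the inputs: filtering the output of a building
block amounts to filtering both inputs and then tracing out one output of the beam splitters. -/
lemma opSqrt_mul_blockOp_mul (hF : IsGaussianFilter F) (hA : IsDensity ρA) (hB : IsDensity ρB) :
    opSqrt F * blockOp F R ρA ρB * opSqrt F =
      partialTrace (beamSplitter m R *
        tensorOp (opSqrt F * ρA * opSqrt F) (opSqrt F * ρB * opSqrt F) *
        (beamSplitter m R).adjoint) := by
  have hW := (hA.isSchmidt.tensor hB.isSchmidt).conj_beamSplitter R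
  rw [blockOp_eq_symmetric R hF.nonneg hA hB,
    ((hW.mul_left _).mul_right _).mul_partialTrace_mul]
  congr 1
  set U := beamSplitter m R with hU
  set P := opSqrt F with hP
  calc tensorOp P 1 * (tensorOp 1 P * (U * tensorOp ρA ρB * U.adjoint) * tensorOp 1 P) *
        tensorOp P 1
      = (tensorOp P 1 * tensorOp 1 P) * U * tensorOp ρA ρB *
          (U.adjoint * (tensorOp 1 P * tensorOp P 1)) := by simp only [mul_assoc]
    _ = (tensorOp P P * U) * tensorOp ρA ρB * (U.adjoint * tensorOp P P) := by
        simp only [tensorOp_mul, one_mul, mul_one]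
    _ = U * (tensorOp P P * tensorOp ρA ρB * tensorOp P P) * U.adjoint := by
        rw [hU, hP, hF.commute_beamSplitter, hF.commute_adjoint_beamSplitter]
        simp only [mul_assoc]
    _ = U * tensorOp (P * ρA * P) (P * ρB * P) * U.adjoint := by
        rw [tensorOp_mul, tensorOp_mul]

lemma opSqrt_mul_mul_ne_zero (hF : IsGaussianFilter F) {ρ : Modes m →L[ℂ] Modes m} (hρ : ρ ≠ 0) :
    opSqrt F * ρ * opSqrt F ≠ 0 := fun h =>
  hρ (eq_zero_of_opSqrt_mul_mul hF.injective_opSqrt h)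

lemma opTrace_filtered_ne_zero (hF : IsGaussianFilter F) {ρ : Modes m →L[ℂ] Modes m}
    (hρ : IsDensity ρ) : opTrace (opSqrt F * ρ * opSqrt F) ≠ 0 := fun h =>
  opSqrt_mul_mul_ne_zero hF hρ.ne_zero ((hρ.isSchmidt.opSqrt_mul_mul F).eq_zero_of_opTrace h)

lemma isDensity_filtered (hF : IsGaussianFilter F) {ρ : Modes m →L[ℂ] Modes m}
    (hρ : IsDensity ρ) : IsDensity (filtered F ρ) :=
  (hρ.isSchmidt.opSqrt_mul_mul F).isDensity_normalize (opSqrt_mul_mul_ne_zero hF hρ.ne_zero)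

lemma opTrace_opSqrt_mul_blockOp_mul (hF : IsGaussianFilter F) (hA : IsDensity ρA)
    (hB : IsDensity ρB) :
    opTrace (opSqrt F * blockOp F R ρA ρB * opSqrt F) =
      opTrace (opSqrt F * ρA * opSqrt F) * opTrace (opSqrt F * ρB * opSqrt F) := by
  have hA' := hA.isSchmidt.opSqrt_mul_mul F
  have hB' := hB.isSchmidt.opSqrt_mul_mul F
  rw [opSqrt_mul_blockOp_mul R hF hA hB,
    ((hA'.tensor hB').conj_beamSplitter R).opTrace_partialTrace,
    (hA'.tensor hB').opTrace_conj_beamSplitter, hA'.opTrace_tensorOp hB']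

/-- A building block succeeds with positive probability. -/
lemma blockOp_ne_zero (hF : IsGaussianFilter F) (hA : IsDensity ρA) (hB : IsDensity ρB) :
    blockOp F R ρA ρB ≠ 0 := by
  intro h
  have h1 := opTrace_opSqrt_mul_blockOp_mul R hF hA hB
  rw [h, mul_zero, zero_mul] at h1
  refine mul_ne_zero (opTrace_filtered_ne_zero hF hA) (opTrace_filtered_ne_zero hF hB) ?_
  rw [← h1]
  simp [opTrace]

lemma isDensity_buildingBlock (hF : IsGaussianFilter F) (hA : IsDensity ρA) (hB : IsDensity ρB) :
    IsDensity (buildingBlock F R ρA ρB) := by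
  obtain ⟨ι, w, h⟩ := exists_isSchmidt_blockOp R hF.nonneg hA hB
  exact h.isDensity_normalize (blockOp_ne_zero R hF hA hB)

lemma filtered_buildingBlock (hF : IsGaussianFilter F) (hA : IsDensity ρA) (hB : IsDensity ρB) :
    filtered F (buildingBlock F R ρA ρB) =
      normalize (opSqrt F * blockOp F R ρA ρB * opSqrt F) := by
  obtain ⟨ι, w, h⟩ := exists_isSchmidt_blockOp R hF.nonneg hA hB
  have h0 : opTrace (blockOp F R ρA ρB) ≠ 0 := fun h0 =>
    blockOp_ne_zero R hF hA hB (h.eq_zero_of_opTrace h0)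
  rw [filtered, buildingBlock]
  nth_rw 2 [normalize]
  rw [mul_smul_comm, smul_mul_assoc, normalize_smul (inv_ne_zero h0)]

lemma charFn_normalize (T : Modes m →L[ℂ] Modes m) (r : Phase m) :
    charFn (normalize T) r = (opTrace T)⁻¹ * charFn T r := by
  rw [charFn, normalize, mul_smul_comm, opTrace_smul]
  rfl

/-- The action of a building block on the characteristic functions of the filtered objects. -/
theorem charFn_filtered_buildingBlock (hF : IsGaussianFilter F) (hA : IsDensity ρA)
    (hB : IsDensity ρB) (r : Phase m) :
    charFn (filtered F (buildingBlock F R ρA ρB)) r =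
      charFn (filtered F ρA) (√(1 - R : ℝ) • r) * charFn (filtered F ρB) (√(R : ℝ) • r) := by
  have hA' := hA.isSchmidt.opSqrt_mul_mul F
  have hB' := hB.isSchmidt.opSqrt_mul_mul F
  have hW := (hA'.tensor hB').conj_beamSplitter R
  have key : charFn (opSqrt F * blockOp F R ρA ρB * opSqrt F) r =
      charFn (opSqrt F * ρA * opSqrt F) (√(1 - R : ℝ) • r) *
        charFn (opSqrt F * ρB * opSqrt F) (√(R : ℝ) • r) := by
    rw [opSqrt_mul_blockOp_mul R hF hA hB, charFn, hW.opTrace_mul_partialTrace, ← weyl_zero,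
      (hA'.tensor hB').opTrace_weyl_beamSplitter, opTrace_weyl_mul_tensorOp hA' hB']
    simp only [smul_zero, sub_zero, add_zero]
  rw [filtered_buildingBlock R hF hA hB, filtered, filtered, charFn_normalize, charFn_normalize,
    charFn_normalize, key, opTrace_opSqrt_mul_blockOp_mul R hF hA hB, mul_inv]
  ring

/-- A state can be recovered from the characteristic function of its filtered object. -/
theorem eq_of_charFn_filtered (hF : IsGaussianFilter F) {ρ ρ' : Modes m →L[ℂ] Modes m}
    (hρ : IsDensity ρ) (hρ' : IsDensity ρ')
    (h : ∀ r, charFn (filtered F ρ) r = charFn (filtered F ρ') r) : ρ = ρ' := by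
  have h1 : filtered F ρ = filtered F ρ' :=
    (isDensity_filtered hF hρ).isSchmidt.eq_of_charFn (isDensity_filtered hF hρ').isSchmidt h
  set t := opTrace (opSqrt F * ρ * opSqrt F) with ht
  set t' := opTrace (opSqrt F * ρ' * opSqrt F) with ht'
  have h2 : t⁻¹ • ρ = t'⁻¹ • ρ' := by
    refine sub_eq_zero.1 (eq_zero_of_opSqrt_mul_mul hF.injective_opSqrt ?_)
    rw [mul_sub, sub_mul, mul_smul_comm, mul_smul_comm, smul_mul_assoc, smul_mul_assoc]
    exact sub_eq_zero.2 h1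
  have h3 := congrArg opTrace h2
  rw [opTrace_smul, opTrace_smul, hρ.2.2, hρ'.2.2, mul_one, mul_one] at h3
  rw [h3] at h2
  exact smul_right_injective _ (inv_ne_zero (opTrace_filtered_ne_zero hF hρ')) h2

end Blocks

/-! ### The pumping and the recursive protocol -/

section Iteration

variable {m : ℕ} {F ρ₁ : Modes m →L[ℂ] Modes m}

lemma sqrt_pumpReflectivity (N : ℕ) :
    √(pumpReflectivity N : ℝ) = 1 / √((N : ℝ) + 1) ∧
      √(1 - pumpReflectivity N : ℝ) = √(N : ℝ) / √((N : ℝ) + 1) := by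
  have hN : (0 : ℝ) < (N : ℝ) + 1 := by positivity
  have h : (pumpReflectivity N : ℝ) = 1 / ((N : ℝ) + 1) := rfl
  have h' : (1 - pumpReflectivity N : ℝ) = N / ((N : ℝ) + 1) := by
    rw [h]; field_simp; ring
  rw [h', h, Real.sqrt_div zero_le_one, Real.sqrt_one, Real.sqrt_div (Nat.cast_nonneg N)]
  exact ⟨rfl, rfl⟩

lemma pumpState_succ {N : ℕ} (hN : 1 ≤ N) :
    pumpState F ρ₁ (N + 1) =
      buildingBlock F (pumpReflectivity N) (pumpState F ρ₁ N) ρ₁ := by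
  obtain ⟨n, rfl⟩ := Nat.exists_eq_add_of_le' hN
  rfl

lemma isDensity_pumpState (hF : IsGaussianFilter F) (hρ : IsDensity ρ₁) {N : ℕ} (hN : 1 ≤ N) :
    IsDensity (pumpState F ρ₁ N) := by
  induction N, hN using Nat.le_induction with
  | base => exact hρ
  | succ N hN ih => rw [pumpState_succ hN]; exact isDensity_buildingBlock _ hF ih hρ

lemma charFn_pumpState_succ (hF : IsGaussianFilter F) (hρ : IsDensity ρ₁) {N : ℕ} (hN : 1 ≤ N)
    (r : Phase m) :
    charFn (filtered F (pumpState F ρ₁ (N + 1))) r =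
      charFn (filtered F (pumpState F ρ₁ N)) ((√(N : ℝ) / √((N : ℝ) + 1)) • r) *
        charFn (filtered F ρ₁) ((1 / √((N : ℝ) + 1)) • r) := by
  rw [pumpState_succ hN, charFn_filtered_buildingBlock _ hF (isDensity_pumpState hF hρ hN) hρ,
    (sqrt_pumpReflectivity N).1, (sqrt_pumpReflectivity N).2]

lemma charFn_pumpState (hF : IsGaussianFilter F) (hρ : IsDensity ρ₁) {N : ℕ} (hN : 1 ≤ N)
    (r : Phase m) :
    charFn (filtered F (pumpState F ρ₁ N)) r = charFn (filtered F ρ₁) ((1 / √(N : ℝ)) • r) ^ N := by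
  induction N, hN using Nat.le_induction generalizing r with
  | base => simp [pumpState]
  | succ N hN ih =>
    have hN0 : √(N : ℝ) ≠ 0 := (Real.sqrt_pos.2 (by exact_mod_cast hN)).ne'
    rw [charFn_pumpState_succ hF hρ hN, ih, smul_smul, pow_succ, Nat.cast_add, Nat.cast_one]
    congr 4
    field_simp

lemma isDensity_recursiveState (hF : IsGaussianFilter F) (hρ : IsDensity ρ₁) (n : ℕ) :
    IsDensity (recursiveState F ρ₁ n) := by
  induction n with
  | zero => exact hρ
  | succ n ih => exact isDensity_buildingBlock _ hF ih ih

lemma charFn_recursiveState (hF : IsGaussianFilter F) (hρ : IsDensity ρ₁) (n : ℕ) (r : Phase m) :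
    charFn (filtered F (recursiveState F ρ₁ n)) r =
      charFn (filtered F ρ₁) ((1 / √((2 ^ n : ℕ) : ℝ)) • r) ^ 2 ^ n := by
  induction n generalizing r with
  | zero => simp [recursiveState]
  | succ n ih =>
    have hd := isDensity_recursiveState hF hρ n
    have h1 : √(halfReflectivity : ℝ) = 1 / √2 := by
      rw [halfReflectivity, Real.sqrt_div zero_le_one, Real.sqrt_one]
    have h2 : √(1 - halfReflectivity : ℝ) = 1 / √2 := by
      rw [← h1]; congr 1; norm_num [halfReflectivity]
    rw [recursiveState, charFn_filtered_buildingBlock _ hF hd hd, h1, h2, ih, smul_smul, ← pow_two,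
      ← pow_mul, ← pow_succ]
    congr 3
    rw [pow_succ, Nat.cast_mul, Real.sqrt_mul (Nat.cast_nonneg _)]
    field_simp
    simp

end Iteration

end Gaussifier
end

open Gaussifier

theorem mainTheorem4 (m : ℕ) (F : Modes m →L[ℂ] Modes m) (hF : IsGaussianFilter F) :
    -- `P ⊗ P` with `P = F^{1/2}` commutes with the beam splitters
    (∀ R : unitInterval,
      (beamSplitter m R).adjoint * tensorOp (opSqrt F) (opSqrt F) * beamSplitter m R =
        tensorOp (opSqrt F) (opSqrt F)) ∧
    -- one building block
    (∀ (R : unitInterval) (ρA ρB : Modes m →L[ℂ] Modes m), IsDensity ρA → IsDensity ρB →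
      IsDensity (buildingBlock F R ρA ρB) ∧
      IsDensity (filtered F ρA) ∧ IsDensity (filtered F ρB) ∧
      IsDensity (filtered F (buildingBlock F R ρA ρB)) ∧
      ∀ r : Phase m, charFn (filtered F (buildingBlock F R ρA ρB)) r =
        charFn (filtered F ρA) (√(1 - R : ℝ) • r) * charFn (filtered F ρB) (√(R : ℝ) • r)) ∧
    ∀ ρ₁ : Modes m →L[ℂ] Modes m, IsDensity ρ₁ →
      -- the pumping protocol
      (∀ N : ℕ, 1 ≤ N →
        IsDensity (pumpState F ρ₁ N) ∧ IsDensity (filtered F (pumpState F ρ₁ N)) ∧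
        ∀ r : Phase m,
          charFn (filtered F (pumpState F ρ₁ (N + 1))) r =
            charFn (filtered F (pumpState F ρ₁ N)) ((√(N : ℝ) / √((N : ℝ) + 1)) • r) *
              charFn (filtered F ρ₁) ((1 / √((N : ℝ) + 1)) • r) ∧
          charFn (filtered F (pumpState F ρ₁ N)) r =
            charFn (filtered F ρ₁) ((1 / √(N : ℝ)) • r) ^ N) ∧
      -- comparison with the recursive protocol of depth `n = log₂ N`
      ∀ n : ℕ,
        IsDensity (recursiveState F ρ₁ n) ∧
        pumpState F ρ₁ (2 ^ n) = recursiveState F ρ₁ n ∧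
        ∀ r : Phase m,
          charFn (filtered F (pumpState F ρ₁ (2 ^ n))) r =
            charFn (filtered F (recursiveState F ρ₁ n)) r := by
  refine ⟨fun R => ?_, fun R ρA ρB hA hB => ?_, fun ρ₁ hρ => ⟨fun N hN => ?_, fun n => ?_⟩⟩
  · rw [hF.commute_adjoint_beamSplitter, mul_assoc, adjoint_beamSplitter_mul_self, mul_one]
  · have hAB := isDensity_buildingBlock R hF hA hB
    exact ⟨hAB, isDensity_filtered hF hA, isDensity_filtered hF hB, isDensity_filtered hF hAB,
      charFn_filtered_buildingBlock R hF hA hB⟩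
  · have hd := isDensity_pumpState hF hρ hN
    exact ⟨hd, isDensity_filtered hF hd, fun r =>
      ⟨charFn_pumpState_succ hF hρ hN r, charFn_pumpState hF hρ hN r⟩⟩
  · have hN : 1 ≤ 2 ^ n := Nat.one_le_two_pow
    have hd := isDensity_recursiveState hF hρ n
    have h : pumpState F ρ₁ (2 ^ n) = recursiveState F ρ₁ n :=
      eq_of_charFn_filtered hF (isDensity_pumpState hF hρ hN) hd fun r => by
        rw [charFn_pumpState hF hρ hN, charFn_recursiveState hF hρ]
    exact ⟨hd, h, fun r => by rw [h]⟩
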